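/- Let $\mathbb K=\mathbb R$ or $\mathbb C$, let all function spaces for $u,u_0,u_1$ consist of $\mathbb K$-valued functions, and write $\mathbb R_+=[0,\infty)$ (derivatives in time at $t=0$ are one-sided). Let $\alpha\in W^{1,\infty}(\mathbb R)$ and $\beta\in L^\infty(\mathbb R)$ be real-valued, with $\alpha\ge\alpha_{\min}>0$ and $\beta\ge\beta_{\min}>0$ almost everywhere on $\mathbb R$, for some constants $\alpha_{\min},\beta_{\min}$. For $u_0\in H^1(\mathbb R)$ and $u_1\in L^2(\mathbb R)$ consider the initial-value problem $$\beta(x)\,\partial_t^2u(x,t)-\partial_x\big(\alpha(x)\,\partial_xu(x,t)\big)=0,\quad x\in\mathbb R,\ t>0,\qquad u(x,0)=u_0(x),\quad \partial_tu(x,0)=u_1(x),\quad x\in\mathbb R. \tag{1}$$ A solution of (1) is understood as a mild solution: a function $u\in C^1(\mathbb R_+,L^2(\mathbb R))\cap C(\mathbb R_+,H^1(\mathbb R))$ with $u(0)=u_0$, $\partial_tu(0)=u_1$ such that, for every $t\ge0$, the $L^2$-valued integral $U(t)=\int_0^tu(s)\,ds$ lies in $H^2(\mathbb R)$ and $\beta\,(\partial_tu(t)-u_1)=\partial_x(\alpha\,\partial_xU(t))$,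 with $\partial_x$ the weak derivative. Then: (i) For all $u_0\in H^1(\mathbb R)$ and $u_1\in L^2(\mathbb R)$, problem (1) has a unique solution $u\in C^1(\mathbb R_+,L^2(\mathbb R))\cap C(\mathbb R_+,H^1(\mathbb R))$. (ii) For every $T>0$ there is a constant $C=C(T,\alpha,\beta)>0$ such that, for all $u_0\in H^1(\mathbb R)$ and $u_1\in L^2(\mathbb R)$, the solution satisfies $$\|u(\cdot,t)\|_{H^1(\mathbb R)}+\|\partial_tu(\cdot,t)\|_{L^2(\mathbb R)}\le C\big(\|u_0\|_{H^1(\mathbb R)}+\|u_1\|_{L^2(\mathbb R)}\big),\qquad 0\le t\le T.$$ (iii) If moreover $u_0\in H^2(\mathbb R)$ and $u_1\in H^1(\mathbb R)$, then $u\in C^2(\mathbb R_+,L^2(\mathbb R))\cap C^1(\mathbb R_+,H^1(\mathbb R))\cap C(\mathbb R_+,H^2(\mathbb R))$. -/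

import Mathlib

open MeasureTheory Set
open scoped ENNReal ContDiff

noncomputable section

/-- `g` is the weak (distributional) derivative of `f` on the real line; both functions are
locally integrable, and the test functions range over `C_c^∞(ℝ)`. -/
def HasWeakDeriv {E : Type*} [NormedAddCommGroup E] [NormedSpace ℝ E] (f g : ℝ → E) : Prop :=
  LocallyIntegrable f ∧ LocallyIntegrable g ∧
    ∀ ψ : ℝ → ℝ, ContDiff ℝ ∞ ψ → HasCompactSupport ψ →
      ∫ x, deriv ψ x • f x = -∫ x, ψ x • g x

/-- The Sobolev space `W^{1,∞}(ℝ)` of real-valued functions. -/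
def MemW1Inf (a : ℝ → ℝ) : Prop :=
  MemLp a ∞ volume ∧ ∃ a' : ℝ → ℝ, MemLp a' ∞ volume ∧ HasWeakDeriv a a'

/-- The space `L²(ℝ; 𝕜)` with respect to Lebesgue measure. -/
abbrev L2R (𝕜 : Type*) [RCLike 𝕜] : Type _ := Lp 𝕜 2 (volume : Measure ℝ)

section WeakDerivLemmas

variable {E : Type*} [NormedAddCommGroup E] [NormedSpace ℝ E]

theorem HasWeakDeriv.congr {f g f' g' : ℝ → E} (h : HasWeakDeriv f g)
    (hf : f' =ᵐ[volume] f) (hg : g' =ᵐ[volume] g) : HasWeakDeriv f' g' := by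
  refine ⟨h.1.congr hf.symm, h.2.1.congr hg.symm, fun ψ h1 h2 => ?_⟩
  have e1 : ∫ x, deriv ψ x • f' x = ∫ x, deriv ψ x • f x :=
    integral_congr_ae (by filter_upwards [hf] with x hx; rw [hx])
  have e2 : ∫ x, ψ x • g' x = ∫ x, ψ x • g x :=
    integral_congr_ae (by filter_upwards [hg] with x hx; rw [hx])
  rw [e1, e2, h.2.2 ψ h1 h2]

theorem HasWeakDeriv.add {f g f' g' : ℝ → E} (h : HasWeakDeriv f g)
    (h' : HasWeakDeriv f' g') : HasWeakDeriv (f + f') (g + g') := by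
  refine ⟨h.1.add h'.1, h.2.1.add h'.2.1, fun ψ h1 h2 => ?_⟩
  have hd : Continuous (deriv ψ) := h1.continuous_deriv (by simp)
  simp only [Pi.add_apply, smul_add]
  rw [integral_add (h.1.integrable_smul_left_of_hasCompactSupport hd h2.deriv)
      (h'.1.integrable_smul_left_of_hasCompactSupport hd h2.deriv),
    integral_add (h.2.1.integrable_smul_left_of_hasCompactSupport h1.continuous h2)
      (h'.2.1.integrable_smul_left_of_hasCompactSupport h1.continuous h2),
    h.2.2 ψ h1 h2, h'.2.2 ψ h1 h2, neg_add]

theorem HasWeakDeriv.zero : HasWeakDeriv (0 : ℝ → E) 0 := by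
  refine ⟨locallyIntegrable_zero, locallyIntegrable_zero, fun ψ _ _ => ?_⟩
  simp

theorem HasWeakDeriv.const_smul {𝕜 : Type*} [RCLike 𝕜] {f g : ℝ → 𝕜} (h : HasWeakDeriv f g)
    (c : 𝕜) : HasWeakDeriv (c • f) (c • g) := by
  refine ⟨h.1.smul c, h.2.1.smul c, fun ψ h1 h2 => ?_⟩
  simp only [Pi.smul_apply, smul_comm _ c]
  rw [integral_smul, integral_smul, h.2.2 ψ h1 h2, smul_neg]

end WeakDerivLemmas

/-- The Sobolev space `H^k(ℝ; 𝕜)`. An element is the tuple `(f, f', …, f^(k))` of an `L²` function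
and its weak derivatives up to order `k`, all in `L²`; the norm is
`(‖f‖² + ‖f'‖² + ⋯ + ‖f^(k)‖²)^(1/2)` with `L²` norms inside. -/
def Hk (𝕜 : Type*) [RCLike 𝕜] (k : ℕ) : Submodule 𝕜 (PiLp 2 fun _ : Fin (k + 1) => L2R 𝕜) where
  carrier := {f | ∀ i : Fin k, HasWeakDeriv (f i.castSucc : ℝ → 𝕜) (f i.succ : ℝ → 𝕜)}
  add_mem' hf hg i := ((hf i).add (hg i)).congr (Lp.coeFn_add _ _) (Lp.coeFn_add _ _)
  zero_mem' _ := HasWeakDeriv.zero.congr (Lp.coeFn_zero _ _ _) (Lp.coeFn_zero _ _ _)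
  smul_mem' c _ hf i := ((hf i).const_smul c).congr (Lp.coeFn_smul _ _) (Lp.coeFn_smul _ _)

/-- The `i`-th weak derivative of an element of `H^k`, as an element of `L²`. -/
def wderiv {𝕜 : Type*} [RCLike 𝕜] {k : ℕ} (f : Hk 𝕜 k) (i : Fin (k + 1)) : L2R 𝕜 :=
  (f : PiLp 2 fun _ : Fin (k + 1) => L2R 𝕜) i

/-- The inclusion of `H^k` in `L²`. -/
def toL2 {𝕜 : Type*} [RCLike 𝕜] {k : ℕ} (f : Hk 𝕜 k) : L2R 𝕜 := wderiv f 0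

/-- The `L²` function `f` belongs to `H^k`. -/
def MemHk {𝕜 : Type*} [RCLike 𝕜] (k : ℕ) (f : L2R 𝕜) : Prop :=
  ∃ F : Hk 𝕜 k, toL2 F = f

/-- `u ∈ C^m(ℝ₊, L²)`, where `ℝ₊ = [0, ∞)` and derivatives at `0` are one-sided. Only the values
of `u` at nonnegative times matter. -/
def MemCmL2 {𝕜 : Type*} [RCLike 𝕜] (m : ℕ) (u : ℝ → L2R 𝕜) : Prop :=
  ContDiffOn ℝ m u (Ici 0)

/-- `u ∈ C^m(ℝ₊, H^k)`: at nonnegative times `u` takes values in `H^k`, and it is of class `C^m`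
with respect to the norm of `H^k`. -/
def MemCmHk {𝕜 : Type*} [RCLike 𝕜] (m k : ℕ) (u : ℝ → L2R 𝕜) : Prop :=
  ∃ F : ℝ → Hk 𝕜 k, ContDiffOn ℝ m F (Ici 0) ∧ ∀ t : ℝ, 0 ≤ t → toL2 (F t) = u t

/-- The time derivative `∂ₜu` in `L²` on `ℝ₊ = [0, ∞)`, one-sided at `0`. -/
def timeDeriv {𝕜 : Type*} [RCLike 𝕜] (u : ℝ → L2R 𝕜) (t : ℝ) : L2R 𝕜 :=
  derivWithin u (Ici 0) t

/-- `u` is a (mild) solution, in `C¹(ℝ₊, L²) ∩ C(ℝ₊, H¹)`, of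
`β ∂ₜ²u = ∂ₓ(α ∂ₓu)` on `ℝ × (0, ∞)` with `u(0) = u₀` and `∂ₜu(0) = u₁`.
The equation is required in its time-integrated form: for every `t ≥ 0` the `L²`-valued integral
`U(t) = ∫₀ᵗ u(s) ds` belongs to `H²`, and `β (∂ₜu(t) - u₁) = ∂ₓ(α ∂ₓU(t))`. -/
structure IsWaveSolution {𝕜 : Type*} [RCLike 𝕜] (α β : ℝ → ℝ) (u₀ : Hk 𝕜 1) (u₁ : L2R 𝕜)
    (u : ℝ → L2R 𝕜) : Prop where
  memC1 : MemCmL2 1 u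
  memC0 : MemCmHk 0 1 u
  init : u 0 = toL2 u₀
  init_deriv : timeDeriv u 0 = u₁
  equation : ∀ t : ℝ, 0 ≤ t → ∃ U : Hk 𝕜 2, toL2 U = ∫ s in (0 : ℝ)..t, u s ∧
    HasWeakDeriv (fun x => α x • (wderiv U 1 : ℝ → 𝕜) x)
      (fun x => β x • (timeDeriv u t - u₁ : L2R 𝕜) x)

end

/-!
The wave equation is rewritten as a first-order system. With `a = √α ∂ₓu` and `c = √β ∂ₜu` it reads
`∂ₜa = √α ∂ₓ(c / √β)`, `∂ₜc = (1 / √β) ∂ₓ(√α a)`. The right-hand side is an operator `L` on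
`X = L² × L²` which is skew-adjoint for the standard inner product, because `∂ₓ` is skew-adjoint on
`L²` and multiplication by `√α` and `√β` is self-adjoint and invertible. Well-posedness of the
system follows from a generation theorem for maximal dissipative operators, and `u` is recovered as
`u₀ + ∫₀ᵗ c / √β`. The coefficient `β` is never differentiated, so `β ∈ L^∞` suffices.

*Generation.* Operators are given by their graphs `G ⊆ X × X`. For a maximal dissipative `L`, the
bounded Yosida approximations `c (c (c - L)⁻¹ - 1)` commute and generate contractions; comparing two
of them on the dense domain of `L` shows that `exp (t L_c) x₀` converges locally uniformly in `t`,
and closedness of `G` turns the limit into a mild solution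
(`IsMaxDissipative.exists_isMildSolution`). Dissipativity gives uniqueness and the contraction
estimate. If `x₀` is in the domain, the mild solution is the primitive of the one that starts at
`L x₀`, hence `C¹` (`IsMaxDissipative.exists_hasDerivWithinAt_of_mem`).

*The resolvent of `L`.* Solving `(μ - L) p = k` amounts to finding the orthogonal projection of a
given element of `X` onto the closed subspace `{(μ √β v, √α ∂ₓv) : v ∈ H¹}`
(`isMaxDissipative_waveGraph`).

*Weak derivatives.* On the line a function with a locally integrable weak derivative agrees almost
everywhere with a locally absolutely continuous function (`HasWeakDeriv.exists_hasACDeriv`). This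
gives the product rule, the derivative of `1 / α`, and integration by parts in `H¹`, that is,
skew-symmetry of `∂ₓ`; maximality is the definition of the weak derivative
(`isSkewAdjointGraph_weakDerivGraph`).

*Translation.* Solutions `u` correspond to mild solutions `(a, c)` starting at `(√α u₀', √β u₁)`.
The initial value is in the domain of `L` exactly for `u₀ ∈ H²` and `u₁ ∈ H¹`, and then
`∂ₓ²u = (β ∂ₜ²u - α' ∂ₓu) / α` is continuous in time with values in `L²`.
-/

open Filter Topology

/-! ### Maximal dissipative operators and their Yosida approximations -/

noncomputable section Generation

variable {𝕜 X : Type*} [RCLike 𝕜] [NormedAddCommGroup X] [InnerProductSpace 𝕜 X]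
  [NormedSpace ℝ X] [IsScalarTower ℝ 𝕜 X]

/-- The norm of a trajectory does not increase if its velocity is dissipative. The time derivative
is real, whereas the inner product is over `𝕜`. -/
theorem norm_le_norm_zero_of_re_inner_nonpos (𝕜 : Type*) [RCLike 𝕜] [InnerProductSpace 𝕜 X]
    {Z Z' : ℝ → X}
    (hZ : ∀ t, 0 ≤ t → HasDerivAt Z (Z' t) t)
    (h : ∀ t, 0 ≤ t → RCLike.re (inner 𝕜 (Z t) (Z' t)) ≤ 0) {t : ℝ} (ht : 0 ≤ t) :
    ‖Z t‖ ≤ ‖Z 0‖ := by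
  have key : ∀ s, 0 ≤ s →
      HasDerivAt (fun s => ‖Z s‖ ^ 2) (2 * RCLike.re (inner 𝕜 (Z s) (Z' s))) s := by
    intro s hs
    have h1 := ((hZ s hs).inner 𝕜 (hZ s hs))
    have h2 := (RCLike.reCLM (K := 𝕜)).hasFDerivAt.comp_hasDerivAt s h1
    have e : (fun s => ‖Z s‖ ^ 2) = (RCLike.reCLM (K := 𝕜)) ∘ fun t => inner 𝕜 (Z t) (Z t) := by
      funext s
      rw [Function.comp_apply, RCLike.reCLM_apply, norm_sq_eq_re_inner (𝕜 := 𝕜)]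
    rw [e]
    convert! h2 using 1
    simp only [RCLike.reCLM_apply, map_add]
    rw [inner_re_symm (Z' s)]
    ring
  have hanti : AntitoneOn (fun s => ‖Z s‖ ^ 2) (Ici 0) := by
    refine antitoneOn_of_deriv_nonpos (convex_Ici 0)
      (fun s hs => (key s hs).continuousAt.continuousWithinAt) ?_ ?_
    · intro s hs
      rw [interior_Ici] at hs
      exact (key s hs.le).differentiableAt.differentiableWithinAt
    · intro s hs
      rw [interior_Ici] at hs
      rw [(key s hs.le).deriv]
      linarith [h s hs.le]
  have := hanti (self_mem_Ici) ht ht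
  exact (sq_le_sq₀ (norm_nonneg _) (norm_nonneg _)).1 this

/-- `G` is the graph of a (single-valued) maximal dissipative operator `L` on `X`: a pair `(x, y)`
lies in `G` when `x` is in the domain of `L` and `y = L x`. -/
structure IsMaxDissipative (G : Submodule 𝕜 (X × X)) : Prop where
  re_inner_nonpos : ∀ p ∈ G, RCLike.re (inner 𝕜 p.1 p.2) ≤ 0
  exists_resolvent : ∀ c : ℝ, 0 < c → ∀ f : X, ∃ p ∈ G, c • p.1 - p.2 = f
  eq_zero : ∀ y : X, ((0 : X), y) ∈ G → y = 0

namespace IsMaxDissipative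

variable {G : Submodule 𝕜 (X × X)} (hG : IsMaxDissipative G)
include hG

/-- Dissipativity in terms of the norm: it makes `c - L` injective with inverse bounded by
`1 / c`. -/
theorem mul_norm_le {p : X × X} (hp : p ∈ G) (c : ℝ) :
    c * ‖p.1‖ ≤ ‖c • p.1 - p.2‖ := by
  have h1 : RCLike.re (inner 𝕜 p.1 (c • p.1 - p.2)) =
      c * ‖p.1‖ ^ 2 - RCLike.re (inner 𝕜 p.1 p.2) := by
    rw [inner_sub_right, RCLike.real_smul_eq_coe_smul (K := 𝕜), inner_smul_real_right, map_sub,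
      RCLike.smul_re, norm_sq_eq_re_inner (𝕜 := 𝕜)]
  have h2 : RCLike.re (inner 𝕜 p.1 (c • p.1 - p.2)) ≤ ‖p.1‖ * ‖c • p.1 - p.2‖ :=
    re_inner_le_norm _ _
  have h3 := hG.re_inner_nonpos p hp
  rcases (norm_nonneg p.1).eq_or_lt with h0 | h0
  · rw [← h0]; simp
  · nlinarith

theorem exists_resolventOp {c : ℝ} (hc : 0 < c) : ∃ R : X →L[ℝ] X,
    (∀ f, (R f, c • R f - f) ∈ G) ∧ (∀ f, c * ‖R f‖ ≤ ‖f‖) ∧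
      ∀ p ∈ G, R (c • p.1 - p.2) = p.1 := by
  choose r hrG hr using hG.exists_resolvent c hc
  have huniq : ∀ p ∈ G, (r (c • p.1 - p.2)).1 = p.1 := by
    intro p hp
    have h1 := hG.mul_norm_le (G.sub_mem (hrG (c • p.1 - p.2)) hp) c
    have h2 : c • ((r (c • p.1 - p.2)) - p).1 - ((r (c • p.1 - p.2)) - p).2 = 0 := by
      have := hr (c • p.1 - p.2)
      simp only [Prod.fst_sub, Prod.snd_sub, smul_sub]
      rw [← sub_eq_zero] at this
      rw [← this]; abel
    rw [h2, norm_zero] at h1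
    have h3 : ‖((r (c • p.1 - p.2)) - p).1‖ = 0 := by
      have := norm_nonneg ((r (c • p.1 - p.2)) - p).1
      nlinarith
    rw [norm_eq_zero, Prod.fst_sub, sub_eq_zero] at h3
    exact h3
  let R₀ : X →ₗ[ℝ] X :=
    { toFun := fun f => (r f).1
      map_add' := fun f g => by
        have := huniq _ (G.add_mem (hrG f) (hrG g))
        rw [← Prod.fst_add, ← this]
        congr 2
        conv_lhs => rw [← hr f, ← hr g]
        simp only [Prod.fst_add, Prod.snd_add, smul_add]; abel
      map_smul' := fun a f => by
        have := huniq _ (G.smul_of_tower_mem a (hrG f))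
        rw [RingHom.id_apply, ← Prod.smul_fst, ← this]
        congr 2
        conv_lhs => rw [← hr f]
        simp only [Prod.smul_fst, Prod.smul_snd, smul_sub, smul_comm a c] }
  have hb : ∀ f, c * ‖R₀ f‖ ≤ ‖f‖ := fun f => by
    have := hG.mul_norm_le (hrG f) c
    rwa [hr f] at this
  refine ⟨R₀.mkContinuous c⁻¹ fun f => ?_, fun f => ?_, hb, huniq⟩
  · rw [inv_mul_eq_div, le_div_iff₀ hc, mul_comm]; exact hb f
  · have : c • (r f).1 - f = (r f).2 := by
      nth_rw 2 [← hr f]; abel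
    simp only [LinearMap.mkContinuous_apply]
    change ((r f).1, c • (r f).1 - f) ∈ G
    rw [this]
    exact hrG f

/-- The resolvent `(c - L)⁻¹` as a bounded real-linear operator. It is characterized by
`resolventOp_spec` for `c > 0`, the only values of `c` at which it is used. -/
def resolventOp (_ : IsMaxDissipative G) (c : ℝ) : X →L[ℝ] X :=
  open Classical in
  if h : ∃ R : X →L[ℝ] X,
    (∀ f, (R f, c • R f - f) ∈ G) ∧ (∀ f, c * ‖R f‖ ≤ ‖f‖) ∧
      ∀ p ∈ G, R (c • p.1 - p.2) = p.1 then h.choose else 0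

variable {c : ℝ} (hc : 0 < c)
include hc

theorem resolventOp_spec : (∀ f, (hG.resolventOp c f, c • hG.resolventOp c f - f) ∈ G) ∧
    (∀ f, c * ‖hG.resolventOp c f‖ ≤ ‖f‖) ∧
      ∀ p ∈ G, hG.resolventOp c (c • p.1 - p.2) = p.1 := by
  have h := hG.exists_resolventOp hc
  rw [resolventOp, dif_pos h]
  exact h.choose_spec

theorem resolventOp_mem (f : X) : (hG.resolventOp c f, c • hG.resolventOp c f - f) ∈ G :=
  (hG.resolventOp_spec hc).1 f

theorem norm_resolventOp_le (f : X) : c * ‖hG.resolventOp c f‖ ≤ ‖f‖ :=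
  (hG.resolventOp_spec hc).2.1 f

theorem resolventOp_eq {p : X × X} (hp : p ∈ G) : hG.resolventOp c (c • p.1 - p.2) = p.1 :=
  (hG.resolventOp_spec hc).2.2 p hp

theorem resolventOp_snd {p : X × X} (hp : p ∈ G) :
    hG.resolventOp c p.2 = c • hG.resolventOp c p.1 - p.1 := by
  have h := hG.resolventOp_eq hc hp
  rw [map_sub, map_smul] at h
  exact eq_sub_of_add_eq' (sub_eq_iff_eq_add.1 h).symm

/-- The resolvent commutes with `L`. -/
theorem resolventOp_map_mem {p : X × X} (hp : p ∈ G) :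
    (hG.resolventOp c p.1, hG.resolventOp c p.2) ∈ G := by
  rw [hG.resolventOp_snd hc hp]
  exact hG.resolventOp_mem hc p.1

theorem resolventOp_commute {d : ℝ} (hd : 0 < d) :
    Commute (hG.resolventOp c) (hG.resolventOp d) := by
  ext f
  have h := hG.resolventOp_eq hd (hG.resolventOp_map_mem hc (hG.resolventOp_mem hd f))
  rw [← map_smul, ← map_sub, sub_sub_cancel] at h
  exact h.symm

omit hc

/-- The Yosida approximation `c (c (c - L)⁻¹ - 1)` of `L`. -/
def yosida (c : ℝ) : X →L[ℝ] X := c • (c • hG.resolventOp c - 1)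

omit [IsScalarTower ℝ 𝕜 X] in
theorem yosida_apply (c : ℝ) (z : X) :
    hG.yosida c z = c • (c • hG.resolventOp c z - z) := rfl

theorem yosida_commute {c d : ℝ} (hc : 0 < c) (hd : 0 < d) :
    Commute (hG.yosida c) (hG.yosida d) :=
  ((((hG.resolventOp_commute hc hd).smul_right d).smul_left c).sub_left
    (Commute.one_left _) |>.sub_right ((Commute.one_right _))).smul_right d |>.smul_left c

include hc

/-- The Yosida approximation is `L` composed with `c (c - L)⁻¹`. -/
theorem yosida_mem (z : X) : (c • hG.resolventOp c z, hG.yosida c z) ∈ G := by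
  have := G.smul_of_tower_mem c (hG.resolventOp_mem hc z)
  exact this

theorem yosida_re_inner_nonpos (z : X) : RCLike.re (inner 𝕜 z (hG.yosida c z)) ≤ 0 := by
  have hz : z = c • hG.resolventOp c z - c⁻¹ • hG.yosida c z := by
    rw [yosida_apply, smul_smul, inv_mul_cancel₀ hc.ne', one_smul]; abel
  have h := hG.re_inner_nonpos _ (hG.yosida_mem hc z)
  nth_rw 1 [hz]
  rw [inner_sub_left, map_sub, RCLike.real_smul_eq_coe_smul (K := 𝕜) c⁻¹, inner_smul_real_left,
    RCLike.smul_re]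
  have h2 : 0 ≤ RCLike.re (inner 𝕜 (hG.yosida c z) (hG.yosida c z)) := inner_self_nonneg
  have h3 : 0 ≤ c⁻¹ * RCLike.re (inner 𝕜 (hG.yosida c z) (hG.yosida c z)) := by positivity
  simp only at h
  linarith

theorem yosida_eq {p : X × X} (hp : p ∈ G) : hG.yosida c p.1 = c • hG.resolventOp c p.2 := by
  rw [yosida_apply, hG.resolventOp_snd hc hp]

omit hc

omit [IsScalarTower ℝ 𝕜 X] in
/-- The domain of a maximal dissipative single-valued operator is dense: an element orthogonal to
the domain is annihilated by the resolvent. -/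
theorem dense_domain [CompleteSpace X] : Dense {x : X | ∃ y, (x, y) ∈ G} := by
  let D : Submodule 𝕜 X := G.map (LinearMap.fst 𝕜 X X)
  have hD : (D : Set X) = {x : X | ∃ y, (x, y) ∈ G} := by
    ext x
    simp [D]
  rw [← hD, Submodule.dense_iff_topologicalClosure_eq_top,
    Submodule.topologicalClosure_eq_top_iff, Submodule.eq_bot_iff]
  intro z hz
  obtain ⟨p, hp, hpz⟩ := hG.exists_resolvent 1 one_pos z
  have h0 : inner 𝕜 p.1 z = 0 := by
    rw [Submodule.mem_orthogonal] at hz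
    exact hz _ (Submodule.mem_map.2 ⟨p, hp, rfl⟩)
  have h1 := hG.re_inner_nonpos p hp
  have h2 : p.2 = p.1 - z := by rw [← hpz]; simp
  rw [h2, inner_sub_right, h0, sub_zero, ← norm_sq_eq_re_inner] at h1
  have h3 : p.1 = 0 := by
    rw [← norm_eq_zero]
    nlinarith [norm_nonneg p.1]
  have h4 : p.2 = 0 := hG.eq_zero _ (by rw [← h3]; exact hp)
  rw [h3, h4] at hpz
  simpa using hpz.symm

/-- The graph is closed, since it is described by the bounded resolvent. -/
theorem isClosed : IsClosed (G : Set (X × X)) := by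
  have : (G : Set (X × X)) = {p | hG.resolventOp 1 ((1 : ℝ) • p.1 - p.2) = p.1} := by
    ext p
    refine ⟨fun hp => hG.resolventOp_eq one_pos hp, fun hp => ?_⟩
    have := hG.resolventOp_mem one_pos ((1 : ℝ) • p.1 - p.2)
    rw [mem_ofPred_eq.mp hp] at this
    simpa using this
  rw [this]
  exact isClosed_eq (by fun_prop) (by fun_prop)

/-- The contractions `c (c - L)⁻¹` tend strongly to the identity as `c → ∞`; on the domain this
follows from `c (c - L)⁻¹ x - x = (c - L)⁻¹ L x`. -/
theorem tendsto_smul_resolventOp [CompleteSpace X] {c : ℕ → ℝ} (hc : ∀ n, 0 < c n)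
    (hc' : Tendsto c atTop atTop) (x : X) :
    Tendsto (fun n => c n • hG.resolventOp (c n) x) atTop (𝓝 x) := by
  rw [Metric.tendsto_atTop]
  intro ε hε
  obtain ⟨d, hdx, y, hd⟩ := Metric.dense_iff.1 hG.dense_domain x (ε / 3) (by positivity)
  obtain ⟨N, hN⟩ := (hc'.eventually_gt_atTop (‖y‖ / (ε / 3))).exists_forall_of_atTop
  refine ⟨N, fun n hn => ?_⟩
  have h1 : ‖c n • hG.resolventOp (c n) (x - d)‖ ≤ ‖x - d‖ := by
    rw [norm_smul, Real.norm_of_nonneg (hc n).le]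
    exact hG.norm_resolventOp_le (hc n) _
  have h2 : ‖c n • hG.resolventOp (c n) d - d‖ < ε / 3 := by
    have e := hG.resolventOp_snd (hc n) hd
    simp only at e
    rw [← e]
    have h4 := hG.norm_resolventOp_le (hc n) y
    have h5 := hN n hn
    rw [div_lt_iff₀ (by positivity)] at h5
    have h6 : c n * ‖hG.resolventOp (c n) y‖ < c n * (ε / 3) := by linarith
    exact lt_of_mul_lt_mul_left h6 (hc n).le
  have h3 : ‖x - d‖ < ε / 3 := by
    rw [← dist_eq_norm, dist_comm]; exact hdx
  rw [dist_eq_norm]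
  calc ‖c n • hG.resolventOp (c n) x - x‖
      = ‖c n • hG.resolventOp (c n) (x - d) + (c n • hG.resolventOp (c n) d - d) - (x - d)‖ := by
        rw [map_sub, smul_sub]; congr 1; abel
    _ ≤ ‖c n • hG.resolventOp (c n) (x - d)‖ + ‖c n • hG.resolventOp (c n) d - d‖ + ‖x - d‖ :=
        (norm_sub_le _ _).trans (by gcongr; exact norm_add_le _ _)
    _ < ε := by linarith

end IsMaxDissipative
end Generation

/-! ### Mild solutions of dissipative evolution equations -/

noncomputable section Evolution

variable {𝕜 X : Type*} [RCLike 𝕜] [NormedAddCommGroup X] [InnerProductSpace 𝕜 X]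
  [NormedSpace ℝ X] [IsScalarTower ℝ 𝕜 X]

/-- Replacing `f` by `s ↦ f (max s 0)` extends a function that is continuous on `[0, ∞)` to a
continuous function on the line without changing its integrals from `0` to `t ≥ 0`. -/
theorem integral_comp_max_zero {E : Type*} [NormedAddCommGroup E] [NormedSpace ℝ E] (f : ℝ → E)
    {t : ℝ} (ht : 0 ≤ t) : ∫ s in (0 : ℝ)..t, f (max s 0) = ∫ s in (0 : ℝ)..t, f s := by
  refine intervalIntegral.integral_congr fun s hs => ?_
  rw [uIcc_of_le ht] at hs
  simp [max_eq_left hs.1]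

theorem ContinuousOn.comp_max_zero {E : Type*} [TopologicalSpace E] {f : ℝ → E}
    (hf : ContinuousOn f (Ici 0)) : Continuous fun s => f (max s 0) :=
  hf.comp_continuous (by fun_prop) fun s => mem_Ici.2 (le_max_right s 0)

theorem ContinuousOn.intervalIntegrable_of_nonneg {E : Type*} [NormedAddCommGroup E] {f : ℝ → E}
    (hf : ContinuousOn f (Ici 0)) {t : ℝ} (ht : 0 ≤ t) : IntervalIntegrable f volume 0 t :=
  (hf.mono (by rw [uIcc_of_le ht]; exact Icc_subset_Ici_self)).intervalIntegrable

theorem hasDerivAt_integral_comp_max_zero {E : Type*} [NormedAddCommGroup E] [NormedSpace ℝ E]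
    [CompleteSpace E] {f : ℝ → E} (hf : ContinuousOn f (Ici 0)) {t : ℝ} (ht : 0 ≤ t) :
    HasDerivAt (fun t => ∫ s in (0 : ℝ)..t, f (max s 0)) (f t) t := by
  have := hf.comp_max_zero.integral_hasStrictDerivAt 0 t
  simpa [max_eq_left ht] using this.hasDerivAt

theorem hasDerivWithinAt_integral_Ici {E : Type*} [NormedAddCommGroup E] [NormedSpace ℝ E]
    [CompleteSpace E] {f : ℝ → E} (hf : ContinuousOn f (Ici 0)) {t : ℝ} (ht : 0 ≤ t) :
    HasDerivWithinAt (fun t => ∫ s in (0 : ℝ)..t, f s) (f t) (Ici 0) t :=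
  (hasDerivAt_integral_comp_max_zero hf ht).hasDerivWithinAt.congr
    (fun _ hs => (integral_comp_max_zero f hs).symm) (integral_comp_max_zero f ht).symm

theorem integral_eq_sub_of_hasDerivWithinAt_Ici {E : Type*} [NormedAddCommGroup E]
    [NormedSpace ℝ E] [CompleteSpace E] {f f' : ℝ → E}
    (hf : ∀ t, 0 ≤ t → HasDerivWithinAt f (f' t) (Ici 0) t) (hf' : ContinuousOn f' (Ici 0))
    {t : ℝ} (ht : 0 ≤ t) : ∫ s in (0 : ℝ)..t, f' s = f t - f 0 := by
  refine intervalIntegral.integral_eq_sub_of_hasDeriv_right ?_ ?_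
    (hf'.intervalIntegrable_of_nonneg ht)
  · rw [uIcc_of_le ht]
    exact fun s hs => ((hf s hs.1).continuousWithinAt).mono Icc_subset_Ici_self
  · rw [min_eq_left ht]
    intro s hs
    exact (hf s hs.1.le).mono (Ioi_subset_Ici_self.trans (Ici_subset_Ici.2 hs.1.le))

theorem Submodule.integral_mem_of_isClosed {E : Type*} [NormedAddCommGroup E] [NormedSpace ℝ E]
    [CompleteSpace E] (S : Submodule ℝ E) (hS : IsClosed (S : Set E)) {f : ℝ → E} {t : ℝ}
    (ht : 0 ≤ t) (hf : ContinuousOn f (Ici 0)) (h : ∀ s, 0 ≤ s → f s ∈ S) :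
    ∫ s in (0 : ℝ)..t, f s ∈ S := by
  have : CompleteSpace S := hS.completeSpace_coe
  let g : ℝ → S := fun s => ⟨f (max s 0), h _ (le_max_right _ _)⟩
  have hg : Continuous g := hf.comp_max_zero.subtype_mk _
  have e := S.subtypeL.intervalIntegral_comp_comm (hg.intervalIntegrable 0 t (μ := volume))
  rw [← integral_comp_max_zero f ht]
  have e2 : ∫ s in (0 : ℝ)..t, f (max s 0) = S.subtypeL (∫ s in (0 : ℝ)..t, g s) := by
    rw [← e]; rfl
  rw [e2]
  exact (∫ s in (0 : ℝ)..t, g s).2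

/-- `W` is a mild solution of `W' = L W` on `[0, ∞)` with `W(0) = x₀`, where `G` is the graph of
`L`: at all times `∫₀ᵗ W` lies in the domain of `L` and `L ∫₀ᵗ W = W(t) - x₀`. -/
structure IsMildSolution (G : Submodule 𝕜 (X × X)) (x₀ : X) (W : ℝ → X) : Prop where
  continuousOn : ContinuousOn W (Ici 0)
  mem : ∀ t, 0 ≤ t → (∫ s in (0 : ℝ)..t, W s, W t - x₀) ∈ G

namespace ContinuousLinearMap

variable [CompleteSpace X]

theorem hasDerivAt_exp_smul_apply (A : X →L[ℝ] X) (x : X) (t : ℝ) :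
    HasDerivAt (fun t : ℝ => NormedSpace.exp (t • A) x) (A (NormedSpace.exp (t • A) x)) t := by
  have h := (hasDerivAt_exp_smul_const' (𝕂 := ℝ) A t)
  exact (ContinuousLinearMap.apply ℝ X x).hasFDerivAt.comp_hasDerivAt t h

theorem norm_exp_smul_apply_le (𝕜 : Type*) [RCLike 𝕜] [InnerProductSpace 𝕜 X] (A : X →L[ℝ] X)
    (hA : ∀ z, RCLike.re (inner 𝕜 z (A z)) ≤ 0) {t : ℝ} (ht : 0 ≤ t) (x : X) :
    ‖NormedSpace.exp (t • A) x‖ ≤ ‖x‖ := by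
  have := norm_le_norm_zero_of_re_inner_nonpos 𝕜
    (fun t _ => hasDerivAt_exp_smul_apply A x t) (fun t _ => hA _) ht
  simpa using this

/-- Two commuting dissipative bounded operators generate evolutions whose difference is controlled
by the difference of the operators on the initial value. -/
theorem norm_exp_smul_apply_sub_le (𝕜 : Type*) [RCLike 𝕜] [InnerProductSpace 𝕜 X]
    (A B : X →L[ℝ] X) (hAB : Commute A B)
    (hA : ∀ z, RCLike.re (inner 𝕜 z (A z)) ≤ 0) (hB : ∀ z, RCLike.re (inner 𝕜 z (B z)) ≤ 0)
    {t : ℝ} (ht : 0 ≤ t) (x : X) :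
    ‖NormedSpace.exp (t • A) x - NormedSpace.exp (t • B) x‖ ≤ t * ‖A x - B x‖ := by
  -- `s ↦ exp ((t - s) A) exp (s B) x` interpolates between the two terms.
  have hd : ∀ s : ℝ, HasDerivAt
      (fun s : ℝ => (NormedSpace.exp ((t - s) • A)) (NormedSpace.exp (s • B) x))
      (-(NormedSpace.exp ((t - s) • A)) (NormedSpace.exp (s • B) (A x - B x))) s := by
    intro s
    have h1 : HasDerivAt (fun s : ℝ => NormedSpace.exp ((t - s) • A))
        (-(NormedSpace.exp ((t - s) • A) * A)) s := by
      have := (hasDerivAt_exp_smul_const (𝕂 := ℝ) A (t - s)).scomp s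
        ((hasDerivAt_id s).const_sub t)
      simpa [Function.comp_def] using this
    have h2 := h1.clm_apply (hasDerivAt_exp_smul_apply B x s)
    convert! h2 using 1
    have c1 : Commute A (NormedSpace.exp (s • B)) := (hAB.smul_right s).exp_right
    have c2 : Commute B (NormedSpace.exp (s • B)) := ((Commute.refl B).smul_right s).exp_right
    have e1 : A (NormedSpace.exp (s • B) x) = NormedSpace.exp (s • B) (A x) :=
      DFunLike.congr_fun c1.eq x
    have e2 : B (NormedSpace.exp (s • B) x) = NormedSpace.exp (s • B) (B x) :=
      DFunLike.congr_fun c2.eq x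
    rw [_root_.neg_apply, mul_apply_eq_comp, e1, e2, map_sub, map_sub]
    abel
  have := norm_image_sub_le_of_norm_deriv_le_segment' (a := 0) (b := t) (C := ‖A x - B x‖)
    (fun s _ => (hd s).hasDerivWithinAt) (fun s hs => ?_) t ⟨ht, le_rfl⟩
  · simp only [sub_self, zero_smul, NormedSpace.exp_zero, one_apply_eq_self,
      sub_zero] at this
    rw [norm_sub_rev, mul_comm]
    exact this
  · rw [norm_neg]
    exact (norm_exp_smul_apply_le 𝕜 A hA (sub_nonneg.2 hs.2.le) _).trans
      (norm_exp_smul_apply_le 𝕜 B hB hs.1 _)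

theorem apply_integral_exp_smul (A : X →L[ℝ] X) (x : X) (t : ℝ) :
    A (∫ s in (0 : ℝ)..t, NormedSpace.exp (s • A) x) = NormedSpace.exp (t • A) x - x := by
  have hc : Continuous fun s : ℝ => NormedSpace.exp (s • A) x :=
    continuous_iff_continuousAt.2 fun s => (hasDerivAt_exp_smul_apply A x s).continuousAt
  rw [← A.intervalIntegral_comp_comm (hc.intervalIntegrable 0 t),
    intervalIntegral.integral_eq_sub_of_hasDerivAt
      (fun s _ => hasDerivAt_exp_smul_apply A x s) ((A.continuous.comp hc).intervalIntegrable 0 t)]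
  simp

end ContinuousLinearMap

namespace IsMaxDissipative

variable {G : Submodule 𝕜 (X × X)} (hG : IsMaxDissipative G)
include hG

/-- The evolutions generated by the Yosida approximations converge uniformly on bounded time
intervals: on the domain because the approximations converge to `L` there, and everywhere because
they are contractions. -/
theorem uniformCauchySeqOn_exp_yosida [CompleteSpace X] (x : X) (T : ℝ) :
    UniformCauchySeqOn
      (fun (n : ℕ) (t : ℝ) => NormedSpace.exp (t • hG.yosida ((n : ℝ) + 1)) x) atTop (Icc 0 T) := by
  have hpos : ∀ n : ℕ, (0 : ℝ) < (n : ℝ) + 1 := fun n => by positivity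
  rcases lt_or_ge T 0 with hT | hT
  · rw [Icc_eq_empty (by linarith), Metric.uniformCauchySeqOn_iff]
    intro ε hε
    exact ⟨0, fun m _ n _ x hx => absurd hx (notMem_empty x)⟩
  rw [Metric.uniformCauchySeqOn_iff]
  intro ε hε
  obtain ⟨d, hdx, y, hd⟩ := Metric.dense_iff.1 hG.dense_domain x (ε / 4) (by positivity)
  have hcau : CauchySeq fun n : ℕ => hG.yosida ((n : ℝ) + 1) d := by
    have h := hG.tendsto_smul_resolventOp hpos
      (tendsto_atTop_add_const_right _ _ tendsto_natCast_atTop_atTop) y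
    refine Tendsto.cauchySeq (x := y) (h.congr fun n => ?_)
    exact (hG.yosida_eq (hpos n) hd).symm
  obtain ⟨N, hN⟩ := Metric.cauchySeq_iff.1 hcau (ε / (4 * (T + 1))) (by positivity)
  refine ⟨N, fun m hm n hn t ht => ?_⟩
  have h1 := ContinuousLinearMap.norm_exp_smul_apply_sub_le 𝕜 _ _
    (hG.yosida_commute (hpos m) (hpos n)) (hG.yosida_re_inner_nonpos (hpos m))
    (hG.yosida_re_inner_nonpos (hpos n)) ht.1 d
  have h2 := ContinuousLinearMap.norm_exp_smul_apply_le 𝕜 _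
    (hG.yosida_re_inner_nonpos (hpos m)) ht.1 (x - d)
  have h3 := ContinuousLinearMap.norm_exp_smul_apply_le 𝕜 _
    (hG.yosida_re_inner_nonpos (hpos n)) ht.1 (x - d)
  have h4 := hN m hm n hn
  rw [dist_eq_norm] at h4
  have h5 : ‖x - d‖ < ε / 4 := by rw [← dist_eq_norm, dist_comm]; exact hdx
  have h6 : t * ‖hG.yosida ((m : ℝ) + 1) d - hG.yosida ((n : ℝ) + 1) d‖ ≤ ε / 4 := by
    calc _ ≤ (T + 1) * (ε / (4 * (T + 1))) :=
          mul_le_mul (by linarith [ht.2]) h4.le (norm_nonneg _) (by positivity)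
      _ = ε / 4 := by field_simp
  rw [dist_eq_norm]
  set E := NormedSpace.exp (t • hG.yosida ((m : ℝ) + 1))
  set F := NormedSpace.exp (t • hG.yosida ((n : ℝ) + 1))
  calc ‖E x - F x‖ = ‖E (x - d) + (E d - F d) - F (x - d)‖ := by
        rw [map_sub, map_sub]; congr 1; abel
    _ ≤ ‖E (x - d)‖ + ‖E d - F d‖ + ‖F (x - d)‖ :=
        (norm_sub_le _ _).trans (by gcongr; exact norm_add_le _ _)
    _ < ε := by linarith

theorem exists_isMildSolution [CompleteSpace X] (x₀ : X) :
    ∃ W, IsMildSolution G x₀ W ∧ ∀ t, 0 ≤ t → ‖W t‖ ≤ ‖x₀‖ := by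
  have hpos : ∀ n : ℕ, (0 : ℝ) < (n : ℝ) + 1 := fun n => by positivity
  set S : ℕ → ℝ → X := fun n t => NormedSpace.exp (t • hG.yosida ((n : ℝ) + 1)) x₀ with hS
  have hSc : ∀ n, Continuous (S n) := fun n => continuous_iff_continuousAt.2 fun s =>
    (ContinuousLinearMap.hasDerivAt_exp_smul_apply _ x₀ s).continuousAt
  have hSb : ∀ n t, 0 ≤ t → ‖S n t‖ ≤ ‖x₀‖ := fun n t ht =>
    ContinuousLinearMap.norm_exp_smul_apply_le 𝕜 _ (hG.yosida_re_inner_nonpos (hpos n)) ht x₀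
  have hlim : ∀ t : ℝ, ∃ w : X, 0 ≤ t → Tendsto (fun n => S n t) atTop (𝓝 w) := by
    intro t
    by_cases ht : 0 ≤ t
    · obtain ⟨w, hw⟩ := cauchySeq_tendsto_of_complete
        ((hG.uniformCauchySeqOn_exp_yosida x₀ t).cauchySeq ⟨ht, le_rfl⟩)
      exact ⟨w, fun _ => hw⟩
    · exact ⟨0, fun h => absurd h ht⟩
  choose W hW using hlim
  have hunif : ∀ T, TendstoUniformlyOn S W atTop (Icc 0 T) := fun T =>
    (hG.uniformCauchySeqOn_exp_yosida x₀ T).tendstoUniformlyOn_of_tendsto fun t ht => hW t ht.1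
  have hWc : ContinuousOn W (Ici 0) := by
    intro t ht
    have h1 : ContinuousOn W (Icc 0 (t + 1)) :=
      (hunif (t + 1)).continuousOn (Frequently.of_forall fun n => (hSc n).continuousOn)
    refine (h1 t ⟨ht, by linarith⟩).mono_of_mem_nhdsWithin ?_
    rw [mem_nhdsWithin_iff_exists_mem_nhds_inter]
    refine ⟨Iio (t + 1), Iio_mem_nhds (by linarith), fun s hs => ⟨hs.2, hs.1.le⟩⟩
  have hWb : ∀ t, 0 ≤ t → ‖W t‖ ≤ ‖x₀‖ := fun t ht =>
    le_of_tendsto (hW t ht).norm (Eventually.of_forall fun n => hSb n t ht)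
  refine ⟨W, ⟨hWc, fun t ht => ?_⟩, hWb⟩
  have hint : Tendsto (fun n => ∫ s in (0 : ℝ)..t, S n s) atTop (𝓝 (∫ s in (0 : ℝ)..t, W s)) := by
    refine intervalIntegral.tendsto_integral_filter_of_dominated_convergence (fun _ => ‖x₀‖)
      (Eventually.of_forall fun n => (hSc n).aestronglyMeasurable) ?_ (by simp) ?_
    · refine Eventually.of_forall fun n => Eventually.of_forall fun s hs => ?_
      rw [uIoc_of_le ht] at hs
      exact hSb n s hs.1.le
    · refine Eventually.of_forall fun s hs => ?_
      rw [uIoc_of_le ht] at hs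
      exact hW s hs.1.le
  -- `c R_c z_c → z` when `z_c → z`, because the operators `c R_c` are contractions.
  have hres : Tendsto (fun n : ℕ => ((n : ℝ) + 1) • hG.resolventOp ((n : ℝ) + 1)
      (∫ s in (0 : ℝ)..t, S n s)) atTop (𝓝 (∫ s in (0 : ℝ)..t, W s)) := by
    have h1 := hG.tendsto_smul_resolventOp hpos
      (tendsto_atTop_add_const_right _ _ tendsto_natCast_atTop_atTop) (∫ s in (0 : ℝ)..t, W s)
    have h2 : Tendsto (fun n : ℕ => ((n : ℝ) + 1) • hG.resolventOp ((n : ℝ) + 1)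
        ((∫ s in (0 : ℝ)..t, S n s) - ∫ s in (0 : ℝ)..t, W s)) atTop (𝓝 0) := by
      refine squeeze_zero_norm (fun n => ?_) (tendsto_iff_norm_sub_tendsto_zero.1 hint)
      rw [norm_smul, Real.norm_of_nonneg (hpos n).le]
      exact hG.norm_resolventOp_le (hpos n) _
    have h3 := h2.add h1
    rw [zero_add] at h3
    refine h3.congr fun n => ?_
    rw [map_sub, smul_sub, sub_add_cancel]
  refine hG.isClosed.mem_of_tendsto (hres.prodMk_nhds ((hW t ht).sub_const x₀))
    (Eventually.of_forall fun n => ?_)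
  have := hG.yosida_mem (hpos n) (∫ s in (0 : ℝ)..t, S n s)
  rw [ContinuousLinearMap.apply_integral_exp_smul] at this
  exact this

omit [IsScalarTower ℝ 𝕜 X] in
/-- The integral `Z` of the difference of two mild solutions satisfies `Z' = L Z` and `Z 0 = 0`, so
it vanishes by dissipativity. -/
theorem isMildSolution_unique [CompleteSpace X] {x₀ : X} {W₁ W₂ : ℝ → X}
    (h₁ : IsMildSolution G x₀ W₁) (h₂ : IsMildSolution G x₀ W₂) {t : ℝ} (ht : 0 ≤ t) :
    W₁ t = W₂ t := by
  have hc : ContinuousOn (fun s => W₁ s - W₂ s) (Ici 0) := h₁.continuousOn.sub h₂.continuousOn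
  have hmem : ∀ s, 0 ≤ s →
      (∫ r in (0 : ℝ)..s, (W₁ (max r 0) - W₂ (max r 0)), W₁ s - W₂ s) ∈ G := by
    intro s hs
    have := G.sub_mem (h₁.mem s hs) (h₂.mem s hs)
    rw [integral_comp_max_zero (fun s => W₁ s - W₂ s) hs, intervalIntegral.integral_sub
      (h₁.continuousOn.intervalIntegrable_of_nonneg hs)
      (h₂.continuousOn.intervalIntegrable_of_nonneg hs)]
    simpa using this
  have hz := norm_le_norm_zero_of_re_inner_nonpos 𝕜
    (fun s hs => hasDerivAt_integral_comp_max_zero hc hs)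
    (fun s hs => hG.re_inner_nonpos _ (hmem s hs)) ht
  rw [intervalIntegral.integral_same, norm_zero, norm_le_zero_iff] at hz
  have := hmem t ht
  rw [hz] at this
  exact sub_eq_zero.1 (hG.eq_zero _ this)

theorem norm_isMildSolution_le [CompleteSpace X] {x₀ : X} {W : ℝ → X}
    (h : IsMildSolution G x₀ W) {t : ℝ} (ht : 0 ≤ t) : ‖W t‖ ≤ ‖x₀‖ := by
  obtain ⟨V, hV, hb⟩ := hG.exists_isMildSolution x₀
  rw [hG.isMildSolution_unique h hV ht]
  exact hb t ht

omit [IsScalarTower ℝ 𝕜 X] in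
theorem isMildSolution_zero {x₀ : X} {W : ℝ → X} (h : IsMildSolution G x₀ W) : W 0 = x₀ := by
  have := h.mem 0 le_rfl
  rw [intervalIntegral.integral_same] at this
  exact sub_eq_zero.1 (hG.eq_zero _ this)

/-- A mild solution that starts in the domain of `L` is a classical solution: it is the primitive
of the mild solution that starts at `L x₀`. -/
theorem exists_hasDerivWithinAt_of_mem [CompleteSpace X] {x₀ y₀ : X} (h₀ : (x₀, y₀) ∈ G)
    {W : ℝ → X} (h : IsMildSolution G x₀ W) :
    ∃ V : ℝ → X, ContinuousOn V (Ici 0) ∧ ∀ t, 0 ≤ t →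
      HasDerivWithinAt W (V t) (Ici 0) t ∧ (W t, V t) ∈ G := by
  obtain ⟨V, hV, -⟩ := hG.exists_isMildSolution y₀
  let Y : ℝ → X := fun t => x₀ + ∫ s in (0 : ℝ)..t, V s
  have hYd : ∀ t, 0 ≤ t → HasDerivWithinAt Y (V t) (Ici 0) t := fun t ht =>
    (hasDerivWithinAt_integral_Ici hV.continuousOn ht).const_add x₀
  have hYc : ContinuousOn Y (Ici 0) := fun t ht => (hYd t ht).continuousWithinAt
  have hYV : ∀ t, 0 ≤ t → (Y t, V t) ∈ G := fun t ht => by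
    simpa [Y] using G.add_mem h₀ (hV.mem t ht)
  have hY : IsMildSolution G x₀ Y := by
    refine ⟨hYc, fun t ht => ?_⟩
    have hc : ContinuousOn (fun t => (Y t, V t)) (Ici 0) := hYc.prodMk hV.continuousOn
    have h1 := Submodule.integral_mem_of_isClosed (G.restrictScalars ℝ) hG.isClosed ht hc hYV
    have h2 : (∫ s in (0 : ℝ)..t, (Y s, V s)) =
        (∫ s in (0 : ℝ)..t, Y s, ∫ s in (0 : ℝ)..t, V s) := by
      have hi := hc.intervalIntegrable_of_nonneg ht
      have e1 := (ContinuousLinearMap.fst ℝ X X).intervalIntegral_comp_comm hi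
      have e2 := (ContinuousLinearMap.snd ℝ X X).intervalIntegral_comp_comm hi
      exact Prod.ext e1.symm e2.symm
    rw [h2] at h1
    have e : Y t - x₀ = ∫ s in (0 : ℝ)..t, V s := by simp [Y]
    rw [e]
    exact h1
  have heq : ∀ t, 0 ≤ t → W t = Y t := fun t ht => hG.isMildSolution_unique h hY ht
  refine ⟨V, hV.continuousOn, fun t ht => ⟨(hYd t ht).congr heq (heq t ht), ?_⟩⟩
  rw [heq t ht]
  exact hYV t ht

end IsMaxDissipative
end Evolution

/-! ### The first-order wave operator -/

noncomputable section WaveOperator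

variable {𝕜 H : Type*} [RCLike 𝕜] [NormedAddCommGroup H] [InnerProductSpace 𝕜 H]

/-- `Γ` is the graph of a skew-adjoint operator `D`: a pair `(x, y)` lies in `Γ` exactly when
`⟪y, z⟫ = -⟪x, D z⟫` for all `z` in the domain, and `D` is single-valued. -/
structure IsSkewAdjointGraph (Γ : Submodule 𝕜 (H × H)) : Prop where
  mem_iff : ∀ p : H × H, p ∈ Γ ↔ ∀ q ∈ Γ, inner 𝕜 p.2 q.1 = -inner 𝕜 p.1 q.2
  eq_zero : ∀ y : H, ((0 : H), y) ∈ Γ → y = 0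

theorem IsSkewAdjointGraph.isClosed {Γ : Submodule 𝕜 (H × H)} (hΓ : IsSkewAdjointGraph Γ) :
    IsClosed (Γ : Set (H × H)) := by
  have : (Γ : Set (H × H)) = ⋂ q ∈ Γ, {p | inner 𝕜 p.2 q.1 = -inner 𝕜 p.1 q.2} := by
    ext p
    simpa using hΓ.mem_iff p
  rw [this]
  exact isClosed_biInter fun q _ => isClosed_eq (by fun_prop) (by fun_prop)

/-- The graph of the operator `(a, c) ↦ (P D (Q⁻¹ c), Q⁻¹ D (P a))` on `H × H`, where `Γ` is the
graph of `D`. -/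
def waveGraph (Γ : Submodule 𝕜 (H × H)) (P Q : H ≃L[𝕜] H) :
    Submodule 𝕜 (WithLp 2 (H × H) × WithLp 2 (H × H)) where
  carrier := {p | (Q.symm p.1.snd, P.symm p.2.fst) ∈ Γ ∧ (P p.1.fst, Q p.2.snd) ∈ Γ}
  add_mem' {p q} hp hq := by
    constructor
    · simpa using Γ.add_mem hp.1 hq.1
    · simpa using Γ.add_mem hp.2 hq.2
  zero_mem' := by
    constructor
    · simp only [Prod.fst_zero, Prod.snd_zero, WithLp.zero_snd, WithLp.zero_fst, map_zero]
      exact Γ.zero_mem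
    · simp only [Prod.fst_zero, Prod.snd_zero, WithLp.zero_snd, WithLp.zero_fst, map_zero]
      exact Γ.zero_mem
  smul_mem' c p hp := by
    constructor
    · simpa using Γ.smul_mem c hp.1
    · simpa using Γ.smul_mem c hp.2

theorem mem_waveGraph {Γ : Submodule 𝕜 (H × H)} {P Q : H ≃L[𝕜] H}
    {p : WithLp 2 (H × H) × WithLp 2 (H × H)} :
    p ∈ waveGraph Γ P Q ↔
      (Q.symm p.1.snd, P.symm p.2.fst) ∈ Γ ∧ (P p.1.fst, Q p.2.snd) ∈ Γ := Iff.rfl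

/-- The wave operator is skew-symmetric, hence dissipative, and `μ - L` is onto for every `μ > 0`. -/
theorem isMaxDissipative_waveGraph [CompleteSpace H] [NormedSpace ℝ H] [IsScalarTower ℝ 𝕜 H]
    {Γ : Submodule 𝕜 (H × H)} (hΓ : IsSkewAdjointGraph Γ) {P Q : H ≃L[𝕜] H}
    (hP : ∀ x y, inner 𝕜 (P x) y = inner 𝕜 x (P y))
    (hQ : ∀ x y, inner 𝕜 (Q x) y = inner 𝕜 x (Q y)) :
    IsMaxDissipative (waveGraph Γ P Q) where
  re_inner_nonpos p hp := by
    obtain ⟨h1, h2⟩ := mem_waveGraph.1 hp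
    have h := (hΓ.mem_iff _).1 h2 _ h1
    simp only at h
    have e1 : inner 𝕜 (Q p.2.snd) (Q.symm p.1.snd) = inner 𝕜 p.2.snd p.1.snd := by
      rw [hQ, Q.apply_symm_apply]
    have e2 : inner 𝕜 (P p.1.fst) (P.symm p.2.fst) = inner 𝕜 p.1.fst p.2.fst := by
      rw [hP, P.apply_symm_apply]
    rw [e1, e2] at h
    have : RCLike.re (inner 𝕜 p.1 p.2) = 0 := by
      rw [WithLp.prod_inner_apply]
      change RCLike.re (inner 𝕜 p.1.fst p.2.fst + inner 𝕜 p.1.snd p.2.snd) = 0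
      rw [map_add, inner_re_symm p.1.snd, h, map_neg, add_neg_cancel]
    exact this.le
  exists_resolvent μ hμ k := by
    have hμ' : (μ : 𝕜) ≠ 0 := by exact_mod_cast hμ.ne'
    -- The range of `(v, D v) ↦ (μ Q v, P D v)` is closed; the resolvent equation says that
    -- its point nearest to `(k₂, -k₁)` is sought.
    let T : WithLp 2 (H × H) →L[𝕜] H × H :=
      ((μ : 𝕜)⁻¹ • (Q.symm : H →L[𝕜] H).comp (WithLp.fstL 2 𝕜 H H)).prod
        ((P.symm : H →L[𝕜] H).comp (WithLp.sndL 2 𝕜 H H))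
    let K : Submodule 𝕜 (WithLp 2 (H × H)) := Γ.comap (T : WithLp 2 (H × H) →ₗ[𝕜] H × H)
    have hK : IsClosed (K : Set (WithLp 2 (H × H))) := hΓ.isClosed.preimage T.continuous
    have : CompleteSpace K := hK.completeSpace_coe
    obtain ⟨y, hy, z, hz, hyz⟩ := K.exists_add_mem_mem_orthogonal
      (WithLp.toLp 2 (k.snd, -k.fst))
    have hyΓ : ((μ : 𝕜)⁻¹ • Q.symm y.fst, P.symm y.snd) ∈ Γ := hy
    have hzy1 : z.fst = k.snd - y.fst := by
      have := congrArg WithLp.fst hyz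
      simp only [WithLp.add_fst] at this
      rw [eq_sub_iff_add_eq, add_comm]; exact this.symm
    have hzy2 : z.snd = -k.fst - y.snd := by
      have := congrArg WithLp.snd hyz
      simp only [WithLp.add_snd] at this
      rw [eq_sub_iff_add_eq, add_comm]; exact this.symm
    refine ⟨(WithLp.toLp 2 (-((μ : 𝕜)⁻¹ • z.snd), (μ : 𝕜)⁻¹ • y.fst),
      WithLp.toLp 2 (y.snd, -z.fst)), mem_waveGraph.2 ⟨?_, ?_⟩, ?_⟩
    · simpa using hyΓ
    · refine (hΓ.mem_iff _).2 fun q hq => ?_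
      have hqK : WithLp.toLp 2 ((μ : 𝕜) • Q q.1, P q.2) ∈ K := by
        change ((μ : 𝕜)⁻¹ • Q.symm ((μ : 𝕜) • Q q.1), P.symm (P q.2)) ∈ Γ
        rw [map_smul, smul_smul, inv_mul_cancel₀ hμ', one_smul, Q.symm_apply_apply,
          P.symm_apply_apply]
        exact hq
      have h0 := (Submodule.mem_orthogonal' _ _).1 hz _ hqK
      rw [WithLp.prod_inner_apply] at h0
      change inner 𝕜 z.fst ((μ : 𝕜) • Q q.1) + inner 𝕜 z.snd (P q.2) = 0 at h0
      change inner 𝕜 (Q (-z.fst)) q.1 = -inner 𝕜 (P (-((μ : 𝕜)⁻¹ • z.snd))) q.2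
      rw [hQ, hP, inner_neg_left, inner_neg_left, inner_smul_left, map_inv₀, RCLike.conj_ofReal,
        eq_neg_of_add_eq_zero_right h0, inner_smul_right]
      field_simp
    · have e1 : μ • (-((μ : 𝕜)⁻¹ • z.snd)) - y.snd = k.fst := by
        rw [RCLike.real_smul_eq_coe_smul (K := 𝕜), smul_neg, smul_smul, mul_inv_cancel₀ hμ',
          one_smul, hzy2]; abel
      have e2 : μ • ((μ : 𝕜)⁻¹ • y.fst) - (-z.fst) = k.snd := by
        rw [RCLike.real_smul_eq_coe_smul (K := 𝕜), smul_smul, mul_inv_cancel₀ hμ',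
          one_smul, hzy1]; abel
      apply WithLp.ofLp_injective
      exact Prod.ext e1 e2
  eq_zero y hy := by
    obtain ⟨h1, h2⟩ := mem_waveGraph.1 hy
    simp only [WithLp.zero_fst, WithLp.zero_snd, map_zero] at h1 h2
    have e1 := hΓ.eq_zero _ h1
    have e2 := hΓ.eq_zero _ h2
    rw [EmbeddingLike.map_eq_zero_iff] at e1 e2
    apply WithLp.ofLp_injective
    exact Prod.ext e1 e2

end WaveOperator

/-! ### Weak derivatives and absolute continuity -/

noncomputable section WeakDerivatives

variable {E : Type*} [NormedAddCommGroup E] [NormedSpace ℝ E]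

/-- `f` is locally absolutely continuous on the real line, `f'` is locally integrable, and `f'` is
the classical derivative of `f` almost everywhere. -/
structure HasACDeriv (f f' : ℝ → E) : Prop where
  absolutelyContinuous : ∀ a b, AbsolutelyContinuousOnInterval f a b
  locallyIntegrable : LocallyIntegrable f'
  ae_hasDerivAt : ∀ᵐ x, HasDerivAt f (f' x) x

theorem AbsolutelyContinuousOnInterval.of_dist_le {X Y : Type*} [PseudoMetricSpace X]
    [PseudoMetricSpace Y] {f : ℝ → X} {g : ℝ → Y} {a b C : ℝ}
    (hf : AbsolutelyContinuousOnInterval f a b)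
    (h : ∀ x ∈ uIcc a b, ∀ y ∈ uIcc a b, dist (g x) (g y) ≤ C * dist (f x) (f y)) :
    AbsolutelyContinuousOnInterval g a b := by
  unfold AbsolutelyContinuousOnInterval at hf ⊢
  refine squeeze_zero' (Eventually.of_forall fun _ => Finset.sum_nonneg fun _ _ => dist_nonneg) ?_
    (by simpa using hf.const_mul C)
  rw [eventually_inf_principal]
  filter_upwards with p hp
  rw [Finset.mul_sum]
  exact Finset.sum_le_sum fun i hi => h _ (hp.1 i hi).1 _ (hp.1 i hi).2

omit [NormedSpace ℝ E] in
theorem MeasureTheory.LocallyIntegrable.intervalIntegrable {f : ℝ → E} (hf : LocallyIntegrable f)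
    (a b : ℝ) : IntervalIntegrable f volume a b :=
  (hf.integrableOn_isCompact isCompact_uIcc).intervalIntegrable

/-- The primitive of a locally integrable function is locally absolutely continuous, since its
increments are dominated by those of the primitive of the norm. -/
theorem hasACDeriv_integral [CompleteSpace E] {g : ℝ → E} (hg : LocallyIntegrable g) :
    HasACDeriv (fun x => ∫ t in (0 : ℝ)..x, g t) g where
  absolutelyContinuous a b := by
    have h0 : IntervalIntegrable (fun x => ‖g x‖) volume a b := (hg.intervalIntegrable a b).norm
    refine (h0.absolutelyContinuousOnInterval_intervalIntegral
      (left_mem_uIcc : a ∈ uIcc a b)).of_dist_le (C := 1) fun x _ y _ => ?_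
    rw [one_mul, dist_comm, dist_comm (∫ v in a..x, _), dist_eq_norm, dist_eq_norm,
      intervalIntegral.integral_interval_sub_left (hg.intervalIntegrable _ _)
        (hg.intervalIntegrable _ _),
      intervalIntegral.integral_interval_sub_left (hg.intervalIntegrable _ _).norm
        (hg.intervalIntegrable _ _).norm]
    exact intervalIntegral.norm_integral_le_abs_integral_norm
  locallyIntegrable := hg
  ae_hasDerivAt := by
    filter_upwards [LocallyIntegrable.ae_hasDerivAt_integral hg] with x hx using hx 0

namespace HasACDeriv

theorem continuous {f f' : ℝ → E} (hf : HasACDeriv f f') : Continuous f := by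
  refine continuous_iff_continuousAt.2 fun x => ?_
  refine ((hf.absolutelyContinuous (x - 1) (x + 1)).continuousOn).continuousAt ?_
  rw [uIcc_of_le (by linarith)]
  exact Icc_mem_nhds (by linarith) (by linarith)

theorem const_add {f f' : ℝ → E} (hf : HasACDeriv f f') (c : E) :
    HasACDeriv (fun x => c + f x) f' where
  absolutelyContinuous a b := (hf.absolutelyContinuous a b).of_dist_le (C := 1) fun x _ y _ => by
    simp
  locallyIntegrable := hf.locallyIntegrable
  ae_hasDerivAt := by filter_upwards [hf.ae_hasDerivAt] with x hx using hx.const_add c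

/-- The fundamental theorem of calculus for absolutely continuous functions. -/
theorem integral_eq_sub [CompleteSpace E] {f f' : ℝ → E} (hf : HasACDeriv f f') (a b : ℝ) :
    ∫ x in a..b, f' x = f b - f a := by
  have h0 := hasACDeriv_integral hf.locallyIntegrable
  have hd : ∀ᵐ x, x ∈ uIcc a b → HasDerivAt (f - fun x => ∫ t in (0 : ℝ)..x, f' t) 0 x := by
    filter_upwards [hf.ae_hasDerivAt, h0.ae_hasDerivAt] with x h1 h2 _
    simpa using h1.sub h2
  obtain ⟨C, hC⟩ := ((hf.absolutelyContinuous a b).sub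
    (h0.absolutelyContinuous a b)).const_of_ae_hasDerivAt_zero hd
  have e : (f - fun x => ∫ t in (0 : ℝ)..x, f' t) b = (f - fun x => ∫ t in (0 : ℝ)..x, f' t) a :=
    (hC b right_mem_uIcc).trans (hC a left_mem_uIcc).symm
  simp only [Pi.sub_apply] at e
  rw [← intervalIntegral.integral_interval_sub_left (hf.locallyIntegrable.intervalIntegrable 0 b)
    (hf.locallyIntegrable.intervalIntegrable 0 a)]
  rw [sub_eq_sub_iff_add_eq_add] at e ⊢
  rw [add_comm, ← e, add_comm]

theorem smul {R : Type*} [NormedField R] [NormedAlgebra ℝ R] [NormedSpace R E] [IsScalarTower ℝ R E]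
    {f f' : ℝ → R} {g g' : ℝ → E}
    (hf : HasACDeriv f f') (hg : HasACDeriv g g') :
    HasACDeriv (fun x => f x • g x) (fun x => f x • g' x + f' x • g x) where
  absolutelyContinuous a b := (hf.absolutelyContinuous a b).smul (hg.absolutelyContinuous a b)
  locallyIntegrable := (hg.locallyIntegrable.continuous_smul hf.continuous).add
    (hf.locallyIntegrable.smul_continuous hg.continuous)
  ae_hasDerivAt := by
    filter_upwards [hf.ae_hasDerivAt, hg.ae_hasDerivAt] with x h1 h2 using h1.smul h2

theorem of_contDiff {ψ : ℝ → E} (hψ : ContDiff ℝ ∞ ψ) : HasACDeriv ψ (deriv ψ) where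
  absolutelyContinuous a b :=
    (hψ.of_le (by exact_mod_cast le_top)).contDiffOn.absolutelyContinuousOnInterval
  locallyIntegrable := (hψ.continuous_deriv (by simp)).locallyIntegrable
  ae_hasDerivAt := Eventually.of_forall fun x =>
    (hψ.differentiable (by simp) x).hasDerivAt

theorem integral_eq_zero_of_hasCompactSupport [CompleteSpace E] {f f' : ℝ → E}
    (hf : HasACDeriv f f') (h1 : HasCompactSupport f) (h2 : HasCompactSupport f') :
    ∫ x, f' x = 0 := by
  obtain ⟨R, hR⟩ := (h1.isCompact.union h2.isCompact).isBounded.subset_closedBall 0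
  have hz : ∀ x, R < |x| → f x = 0 ∧ f' x = 0 := by
    intro x hx
    have : x ∉ tsupport f ∪ tsupport f' := fun h => by
      have := hR h
      rw [mem_closedBall_zero_iff, Real.norm_eq_abs] at this
      linarith
    rw [mem_union, not_or] at this
    exact ⟨image_eq_zero_of_notMem_tsupport this.1, image_eq_zero_of_notMem_tsupport this.2⟩
  set S := |R| + 1
  have hS : R < S := by have := le_abs_self R; simp only [S]; linarith
  have hS0 : 0 < S := by positivity
  rw [← intervalIntegral.integral_eq_integral_of_support_subset (a := -S) (b := S) ?_,
    hf.integral_eq_sub, (hz S ?_).1, (hz (-S) ?_).1, sub_zero]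
  · rwa [abs_neg, abs_of_pos hS0]
  · rwa [abs_of_pos hS0]
  · intro x hx
    by_contra hx'
    refine hx (hz x ?_).2
    by_contra hle
    have := abs_le.1 (not_lt.1 hle)
    exact hx' ⟨by linarith, by linarith⟩

/-- Integration by parts against a test function. -/
theorem hasWeakDeriv [CompleteSpace E] {f f' : ℝ → E} (hf : HasACDeriv f f') :
    HasWeakDeriv f f' := by
  refine ⟨hf.continuous.locallyIntegrable, hf.locallyIntegrable, fun ψ h1 h2 => ?_⟩
  have hp := (of_contDiff h1).smul hf
  have hd : Continuous (deriv ψ) := h1.continuous_deriv (by simp)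
  have := hp.integral_eq_zero_of_hasCompactSupport h2.smul_right
    (h2.smul_right.add h2.deriv.smul_right)
  rw [integral_add (hf.locallyIntegrable.integrable_smul_left_of_hasCompactSupport h1.continuous h2)
    (hf.continuous.locallyIntegrable.integrable_smul_left_of_hasCompactSupport hd h2.deriv)] at this
  exact eq_neg_of_add_eq_zero_right this

end HasACDeriv

/-- The lemma of du Bois-Reymond: a function with vanishing weak derivative is constant. -/
theorem HasWeakDeriv.ae_eq_const [CompleteSpace E] {f : ℝ → E} (hf : HasWeakDeriv f 0) :
    ∃ c : E, f =ᵐ[volume] fun _ => c := by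
  let b : ContDiffBump (0 : ℝ) := ⟨1, 2, one_pos, one_lt_two⟩
  let ρ : ℝ → ℝ := b.normed volume
  have hρ : ContDiff ℝ ∞ ρ := b.contDiff_normed
  have hρs : HasCompactSupport ρ := b.hasCompactSupport_normed
  have hρ1 : ∫ x, ρ x = 1 := b.integral_normed
  refine ⟨∫ x, ρ x • f x, ?_⟩
  refine ae_eq_of_integral_contDiff_smul_eq hf.1 (locallyIntegrable_const _) fun φ h1 h2 => ?_
  -- `φ - (∫ φ) ρ` has integral zero, so it is the derivative of a test function.
  let η : ℝ → ℝ := fun x => φ x - (∫ y, φ y) * ρ x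
  have hη : ContDiff ℝ ∞ η := h1.sub (contDiff_const.mul hρ)
  have hηs : HasCompactSupport η := h2.sub (hρs.mul_left)
  have hφi : Integrable φ := h1.continuous.integrable_of_hasCompactSupport h2
  have hρi : Integrable ρ := hρ.continuous.integrable_of_hasCompactSupport hρs
  have hη0 : ∫ x, η x = 0 := by
    simp only [η]
    rw [integral_sub hφi (hρi.const_mul _), integral_const_mul, hρ1, mul_one, sub_self]
  obtain ⟨ψ, hψ, hψs, hψd⟩ : ∃ ψ : ℝ → ℝ, ContDiff ℝ ∞ ψ ∧ HasCompactSupport ψ ∧ deriv ψ = η := by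
    obtain ⟨R, hR⟩ := hηs.isCompact.isBounded.subset_closedBall 0
    have hz : ∀ x, R < |x| → η x = 0 := fun x hx => by
      refine image_eq_zero_of_notMem_tsupport fun h => ?_
      have := hR h
      rw [mem_closedBall_zero_iff, Real.norm_eq_abs] at this
      linarith
    set S := |R| + 1
    have hS : R < S := by have := le_abs_self R; simp only [S]; linarith
    have hS0 : 0 < S := by positivity
    let ψ : ℝ → ℝ := fun x => ∫ t in (-S)..x, η t
    have hd : ∀ x, HasDerivAt ψ (η x) x := fun x =>
      (hη.continuous.integral_hasStrictDerivAt (-S) x).hasDerivAt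
    have hde : deriv ψ = η := funext fun x => (hd x).deriv
    refine ⟨ψ, ?_, ?_, hde⟩
    · rw [contDiff_infty_iff_deriv, hde]
      exact ⟨fun x => (hd x).differentiableAt, hη⟩
    · refine HasCompactSupport.of_support_subset_isCompact (isCompact_Icc (a := -S) (b := S)) ?_
      intro x hx
      by_contra hx'
      refine hx ?_
      rw [mem_Icc, not_and_or, not_le, not_le] at hx'
      rcases hx' with hx' | hx'
      · refine intervalIntegral.integral_zero_ae (Eventually.of_forall fun t ht => hz t ?_)
        rw [uIoc_of_ge hx'.le] at ht
        rw [abs_of_neg (by linarith [ht.2])]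
        linarith [ht.2]
      · simp only [ψ]
        rw [intervalIntegral.integral_eq_integral_of_support_subset, hη0]
        intro t ht
        by_contra ht'
        refine ht (hz t ?_)
        by_contra hle
        have := abs_le.1 (not_lt.1 hle)
        exact ht' ⟨by linarith, by linarith⟩
  have key := hf.2.2 ψ hψ hψs
  rw [hψd] at key
  simp only [Pi.zero_apply, smul_zero, integral_zero, neg_zero, η, sub_smul, mul_smul] at key
  have i1 := hf.1.integrable_smul_left_of_hasCompactSupport h1.continuous h2
  have i2 := hf.1.integrable_smul_left_of_hasCompactSupport hρ.continuous hρs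
  have i3 : Integrable fun x => (∫ y, φ y) • ρ x • f x := i2.smul _
  rw [integral_sub i1 i3, integral_smul, sub_eq_zero] at key
  rw [key, integral_smul_const]

/-- A weakly differentiable function on the line has a locally absolutely continuous
representative. -/
theorem HasWeakDeriv.exists_hasACDeriv [CompleteSpace E] {f g : ℝ → E} (hf : HasWeakDeriv f g) :
    ∃ F, f =ᵐ[volume] F ∧ HasACDeriv F g := by
  have h0 := hasACDeriv_integral hf.2.1
  have hw := h0.hasWeakDeriv
  have : HasWeakDeriv (f - fun x => ∫ t in (0 : ℝ)..x, g t) 0 := by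
    refine ⟨hf.1.sub hw.1, locallyIntegrable_zero, fun ψ h1 h2 => ?_⟩
    have hd : Continuous (deriv ψ) := h1.continuous_deriv (by simp)
    simp only [Pi.sub_apply, smul_sub, Pi.zero_apply, smul_zero, integral_zero, neg_zero]
    rw [integral_sub (hf.1.integrable_smul_left_of_hasCompactSupport hd h2.deriv)
      (hw.1.integrable_smul_left_of_hasCompactSupport hd h2.deriv), hf.2.2 ψ h1 h2,
      hw.2.2 ψ h1 h2, sub_self]
  obtain ⟨c, hc⟩ := this.ae_eq_const
  refine ⟨_, ?_, h0.const_add c⟩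
  filter_upwards [hc] with x hx
  rw [← hx, Pi.sub_apply, sub_add_cancel]

theorem HasWeakDeriv.unique [CompleteSpace E] {f g g' : ℝ → E} (h : HasWeakDeriv f g)
    (h' : HasWeakDeriv f g') : g =ᵐ[volume] g' :=
  ae_eq_of_integral_contDiff_smul_eq h.2.1 h'.2.1 fun ψ h1 h2 =>
    neg_injective ((h.2.2 ψ h1 h2).symm.trans (h'.2.2 ψ h1 h2))

/-- The product rule for weak derivatives. -/
theorem HasWeakDeriv.smul {R : Type*} [NormedField R] [NormedAlgebra ℝ R] [CompleteSpace R]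
    [NormedSpace R E] [IsScalarTower ℝ R E] [CompleteSpace E]
    {f f' : ℝ → R} {g g' : ℝ → E} (hf : HasWeakDeriv f f') (hg : HasWeakDeriv g g') :
    HasWeakDeriv (fun x => f x • g x) (fun x => f x • g' x + f' x • g x) := by
  obtain ⟨F, hF, hF'⟩ := hf.exists_hasACDeriv
  obtain ⟨K, hK, hK'⟩ := hg.exists_hasACDeriv
  refine (hF'.smul hK').hasWeakDeriv.congr ?_ ?_
  · filter_upwards [hF, hK] with x h1 h2; rw [h1, h2]
  · filter_upwards [hF, hK] with x h1 h2; rw [h1, h2]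

/-- The reciprocal of a weakly differentiable function bounded below by a positive constant. -/
theorem HasWeakDeriv.inv {f f' : ℝ → ℝ} (hf : HasWeakDeriv f f') {m : ℝ} (hm : 0 < m)
    (hfm : ∀ᵐ x, m ≤ f x) : HasWeakDeriv (fun x => (f x)⁻¹) (fun x => -f' x / f x ^ 2) := by
  obtain ⟨F, hF, hF'⟩ := hf.exists_hasACDeriv
  -- The continuous representative obeys the lower bound everywhere, so that its reciprocal is again
  -- locally absolutely continuous.
  have hFm : ∀ x, m ≤ F x := by
    have h1 : Dense {x | m ≤ F x} := Measure.dense_of_ae (μ := volume) (by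
      filter_upwards [hF, hfm] with x h1 h2; rwa [← h1])
    exact fun x => (isClosed_le continuous_const hF'.continuous).closure_subset (h1 x)
  have hpos : ∀ x, 0 < F x := fun x => hm.trans_le (hFm x)
  have : HasACDeriv (fun x => (F x)⁻¹) (fun x => -f' x / F x ^ 2) := by
    refine ⟨fun a b => (hF'.absolutelyContinuous a b).of_dist_le (C := (m ^ 2)⁻¹)
      fun x _ y _ => ?_, ?_, ?_⟩
    · rw [Real.dist_eq, Real.dist_eq, inv_sub_inv (hpos x).ne' (hpos y).ne', abs_div,
        abs_sub_comm, abs_of_pos (mul_pos (hpos x) (hpos y)), div_eq_inv_mul]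
      gcongr
      nlinarith [hFm x, hFm y]
    · have h1 : Continuous fun x => -(F x ^ 2)⁻¹ :=
        ((hF'.continuous.pow 2).inv₀ fun x => (pow_pos (hpos x) 2).ne').neg
      refine (hF'.locallyIntegrable.continuous_smul h1).congr (Eventually.of_forall fun x => ?_)
      simp only [smul_eq_mul]
      ring
    · filter_upwards [hF'.ae_hasDerivAt] with x hx using hx.inv (hpos x).ne'
  refine this.hasWeakDeriv.congr ?_ ?_
  · filter_upwards [hF] with x h1; rw [h1]
  · filter_upwards [hF] with x h1; rw [h1]

/-- An integrable function with integrable weak derivative tends to zero at infinity, so the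
integral of its derivative vanishes. -/
theorem HasWeakDeriv.integral_eq_zero [CompleteSpace E] {f f' : ℝ → E} (hf : HasWeakDeriv f f')
    (h : Integrable f) (h' : Integrable f') : ∫ x, f' x = 0 := by
  obtain ⟨F, hF, hF'⟩ := hf.exists_hasACDeriv
  have hFi : Integrable F := h.congr hF
  -- The integrable function `F b - F (-b)` tends to `∫ f'` as `b → ∞`, which must therefore be zero.
  let k : ℝ → E := fun b => F b - F (-b)
  have hk : Integrable k := hFi.sub hFi.comp_neg
  have ht : Tendsto k atTop (𝓝 (∫ x, f' x)) := by
    have := intervalIntegral_tendsto_integral h' (tendsto_neg_atTop_atBot) tendsto_id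
    refine this.congr fun b => ?_
    exact hF'.integral_eq_sub _ _
  by_contra hL
  have hL' : 0 < ‖∫ x, f' x‖ / 2 := by have := norm_pos_iff.2 hL; positivity
  obtain ⟨B, hB⟩ := (ht.norm.eventually (lt_mem_nhds (half_lt_self
    (norm_pos_iff.2 hL)))).exists_forall_of_atTop
  have h1 := hk.measure_norm_ge_lt_top hL'
  have h2 : volume (Ici B) ≤ volume {x | ‖∫ x, f' x‖ / 2 ≤ ‖k x‖} :=
    measure_mono fun x hx => (hB x hx).le
  rw [Real.volume_Ici] at h2
  exact absurd (h2.trans_lt h1) (lt_irrefl _)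

end WeakDerivatives

/-! ### The weak derivative on `L²` and Sobolev spaces -/

noncomputable section SobolevSpaces

variable {𝕜 : Type*} [RCLike 𝕜]

theorem HasWeakDeriv.clm_comp {E F : Type*} [NormedAddCommGroup E] [NormedSpace ℝ E]
    [NormedAddCommGroup F] [NormedSpace ℝ F] [CompleteSpace E] [CompleteSpace F]
    {f g : ℝ → E} (h : HasWeakDeriv f g) (L : E →L[ℝ] F) :
    HasWeakDeriv (fun x => L (f x)) (fun x => L (g x)) := by
  have key : ∀ {f : ℝ → E}, LocallyIntegrable f → LocallyIntegrable fun x => L (f x) :=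
    fun hf x => let ⟨s, hs, hi⟩ := hf x; ⟨s, hs, L.integrable_comp hi⟩
  refine ⟨key h.1, key h.2.1, fun ψ h1 h2 => ?_⟩
  have hd : Continuous (deriv ψ) := h1.continuous_deriv (by simp)
  simp only [← map_smul]
  rw [L.integral_comp_comm (h.1.integrable_smul_left_of_hasCompactSupport hd h2.deriv),
    L.integral_comp_comm (h.2.1.integrable_smul_left_of_hasCompactSupport h1.continuous h2),
    h.2.2 ψ h1 h2, map_neg]

theorem Lp.locallyIntegrable_coeFn (f : L2R 𝕜) : LocallyIntegrable (f : ℝ → 𝕜) :=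
  (Lp.memLp f).locallyIntegrable (by norm_num)

variable (𝕜) in
/-- The graph of the weak derivative on `L²`, with domain `H¹`. -/
def weakDerivGraph : Submodule 𝕜 (L2R 𝕜 × L2R 𝕜) where
  carrier := {p | HasWeakDeriv (p.1 : ℝ → 𝕜) (p.2 : ℝ → 𝕜)}
  add_mem' hp hq := (HasWeakDeriv.add hp hq).congr (Lp.coeFn_add _ _) (Lp.coeFn_add _ _)
  zero_mem' := HasWeakDeriv.zero.congr (Lp.coeFn_zero _ _ _) (Lp.coeFn_zero _ _ _)
  smul_mem' c _ hp := (HasWeakDeriv.const_smul hp c).congr (Lp.coeFn_smul _ _)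
    (Lp.coeFn_smul _ _)

theorem mem_weakDerivGraph {p : L2R 𝕜 × L2R 𝕜} :
    p ∈ weakDerivGraph 𝕜 ↔ HasWeakDeriv (p.1 : ℝ → 𝕜) (p.2 : ℝ → 𝕜) := Iff.rfl

/-- A test function and its derivative form an element of the graph of the weak derivative. -/
theorem toLp_mem_weakDerivGraph {ψ : ℝ → ℝ} (h1 : ContDiff ℝ ∞ ψ) (h2 : HasCompactSupport ψ) :
    ∃ q ∈ weakDerivGraph 𝕜, q.1 =ᵐ[volume] (fun x => (ψ x : 𝕜)) ∧
      q.2 =ᵐ[volume] fun x => ((deriv ψ x : ℝ) : 𝕜) := by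
  have hd : Continuous (deriv ψ) := h1.continuous_deriv (by simp)
  have m1 : MemLp (fun x => (ψ x : 𝕜)) 2 volume :=
    (h1.continuous.memLp_of_hasCompactSupport h2).ofReal
  have m2 : MemLp (fun x => ((deriv ψ x : ℝ) : 𝕜)) 2 volume :=
    (hd.memLp_of_hasCompactSupport h2.deriv).ofReal
  refine ⟨(m1.toLp, m2.toLp), ?_, m1.coeFn_toLp, m2.coeFn_toLp⟩
  exact (((HasACDeriv.of_contDiff h1).hasWeakDeriv).clm_comp (RCLike.ofRealCLM (K := 𝕜))).congr
    m1.coeFn_toLp m2.coeFn_toLp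

variable (𝕜) in
/-- The weak derivative on `L²` is skew-adjoint. Skew-symmetry is integration by parts in `H¹`;
maximality holds because test functions belong to the domain. -/
theorem isSkewAdjointGraph_weakDerivGraph : IsSkewAdjointGraph (weakDerivGraph 𝕜) where
  mem_iff p := by
    constructor
    · intro hp q hq
      rw [mem_weakDerivGraph] at hp hq
      rw [eq_neg_iff_add_eq_zero, add_comm, L2.inner_def, L2.inner_def,
        ← integral_add (L2.integrable_inner _ _) (L2.integrable_inner _ _)]
      have hw := (hp.clm_comp (RCLike.conjCLE (K := 𝕜) : 𝕜 →L[ℝ] 𝕜)).smul hq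
      have i1 := L2.integrable_inner (𝕜 := 𝕜) p.1 q.1
      have i2 := (L2.integrable_inner (𝕜 := 𝕜) p.1 q.2).add
        (L2.integrable_inner (𝕜 := 𝕜) p.2 q.1)
      have e1 : (fun x => inner 𝕜 (p.1 x) (q.1 x)) =
          fun x => (RCLike.conjCLE (K := 𝕜) : 𝕜 →L[ℝ] 𝕜) (p.1 x) • q.1 x := by
        funext x; simp [RCLike.inner_apply, mul_comm]
      have e2 : (fun x => inner 𝕜 (p.1 x) (q.2 x) + inner 𝕜 (p.2 x) (q.1 x)) =
          fun x => (RCLike.conjCLE (K := 𝕜) : 𝕜 →L[ℝ] 𝕜) (p.1 x) • q.2 x +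
            (RCLike.conjCLE (K := 𝕜) : 𝕜 →L[ℝ] 𝕜) (p.2 x) • q.1 x := by
        funext x; simp [RCLike.inner_apply, mul_comm]
      rw [← e1, ← e2] at hw
      exact hw.integral_eq_zero i1 i2
    · intro h
      refine ⟨Lp.locallyIntegrable_coeFn _, Lp.locallyIntegrable_coeFn _, fun ψ h1 h2 => ?_⟩
      obtain ⟨q, hq, hq1, hq2⟩ := toLp_mem_weakDerivGraph (𝕜 := 𝕜) h1 h2
      have := congrArg (starRingEnd 𝕜) (h q hq)
      rw [map_neg, inner_conj_symm, inner_conj_symm, L2.inner_def, L2.inner_def] at this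
      rw [eq_neg_iff_add_eq_zero, add_comm, ← eq_neg_iff_add_eq_zero]
      convert this using 1
      · refine integral_congr_ae ?_
        filter_upwards [hq1] with x hx
        rw [hx, RCLike.inner_apply, RCLike.conj_ofReal, RCLike.real_smul_eq_coe_mul, mul_comm]
      · congr 1
        refine integral_congr_ae ?_
        filter_upwards [hq2] with x hx
        rw [hx, RCLike.inner_apply, RCLike.conj_ofReal, RCLike.real_smul_eq_coe_mul, mul_comm]
  eq_zero y hy := by
    have h0 : HasWeakDeriv ((0 : L2R 𝕜) : ℝ → 𝕜) ((0 : L2R 𝕜) : ℝ → 𝕜) :=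
      (weakDerivGraph 𝕜).zero_mem
    exact Lp.ext (hy.unique h0)

theorem weakDerivGraph_unique {f g g' : L2R 𝕜} (h : (f, g) ∈ weakDerivGraph 𝕜)
    (h' : (f, g') ∈ weakDerivGraph 𝕜) : g = g' :=
  Lp.ext (HasWeakDeriv.unique h h')

/-- Multiplication by a real-valued `L^∞` function, as a bounded operator on `L²`. -/
def mulL2 (φ : ℝ → ℝ) (hφ : MemLp φ ∞ volume) : L2R 𝕜 →L[𝕜] L2R 𝕜 :=
  (ContinuousLinearMap.mul 𝕜 𝕜).holderL volume ∞ 2 2 (MemLp.toLp _ (hφ.ofReal (K := 𝕜)))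

theorem coeFn_mulL2 {φ : ℝ → ℝ} (hφ : MemLp φ ∞ volume) (f : L2R 𝕜) :
    mulL2 φ hφ f =ᵐ[volume] fun x => φ x • f x := by
  have h1 := ContinuousLinearMap.coeFn_holder (r := 2) (ContinuousLinearMap.mul 𝕜 𝕜)
    (MemLp.toLp _ (hφ.ofReal (K := 𝕜))) f
  have h2 := MemLp.coeFn_toLp (hφ.ofReal (K := 𝕜))
  filter_upwards [h1, h2] with x hx1 hx2
  rw [RCLike.real_smul_eq_coe_mul, ← hx2]
  exact hx1

theorem memLp_top_sqrt {φ : ℝ → ℝ} (hφ : MemLp φ ∞ volume) (h : ∀ᵐ x, 0 ≤ φ x) :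
    MemLp (fun x => √(φ x)) ∞ volume := by
  refine ((memLp_top_const (1 : ℝ)).add hφ).mono
    (Real.continuous_sqrt.comp_aestronglyMeasurable hφ.1) ?_
  filter_upwards [h] with x hx
  rw [Real.norm_of_nonneg (Real.sqrt_nonneg _), Pi.add_apply,
    Real.norm_of_nonneg (by positivity), Real.sqrt_le_left (by positivity)]
  nlinarith

theorem memLp_top_inv {φ : ℝ → ℝ} (hφ : AEStronglyMeasurable φ volume) {m : ℝ} (hm : 0 < m)
    (h : ∀ᵐ x, m ≤ φ x) : MemLp (fun x => (φ x)⁻¹) ∞ volume := by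
  refine memLp_top_of_bound hφ.aemeasurable.inv.aestronglyMeasurable m⁻¹ ?_
  filter_upwards [h] with x hx
  rw [norm_inv, Real.norm_of_nonneg (hm.le.trans hx)]
  gcongr

/-- Multiplication by the square root of a bounded function that is bounded below by a positive
constant is a self-adjoint isomorphism of `L²`. -/
theorem exists_mulL2_sqrt {φ : ℝ → ℝ} (hφ : MemLp φ ∞ volume) {m : ℝ} (hm : 0 < m)
    (h : ∀ᵐ x, m ≤ φ x) : ∃ P : L2R 𝕜 ≃L[𝕜] L2R 𝕜,
      (∀ f g, inner 𝕜 (P f) g = inner 𝕜 f (P g)) ∧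
      ∀ f, P (P f) =ᵐ[volume] fun x => φ x • f x := by
  have h0 : ∀ᵐ x, 0 ≤ φ x := by filter_upwards [h] with x hx using hm.le.trans hx
  have hs := memLp_top_sqrt hφ h0
  have hsm : ∀ᵐ x, √m ≤ √(φ x) := by filter_upwards [h] with x hx using Real.sqrt_le_sqrt hx
  have hi := memLp_top_inv hs.1 (Real.sqrt_pos.2 hm) hsm
  refine ⟨ContinuousLinearEquiv.equivOfInverse (mulL2 _ hs) (mulL2 _ hi) (fun f => ?_)
    (fun f => ?_), fun f g => ?_, fun f => ?_⟩
  · refine Lp.ext ?_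
    filter_upwards [coeFn_mulL2 hi (mulL2 _ hs f), coeFn_mulL2 hs f, hsm] with x h1 h2 h3
    rw [h1, h2, smul_smul, inv_mul_cancel₀ ((Real.sqrt_pos.2 hm).trans_le h3).ne', one_smul]
  · refine Lp.ext ?_
    filter_upwards [coeFn_mulL2 hs (mulL2 _ hi f), coeFn_mulL2 hi f, hsm] with x h1 h2 h3
    rw [h1, h2, smul_smul, mul_inv_cancel₀ ((Real.sqrt_pos.2 hm).trans_le h3).ne', one_smul]
  · change inner 𝕜 (mulL2 _ hs f) g = inner 𝕜 f (mulL2 _ hs g)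
    rw [L2.inner_def, L2.inner_def]
    refine integral_congr_ae ?_
    filter_upwards [coeFn_mulL2 hs f, coeFn_mulL2 hs g] with x h1 h2
    rw [h1, h2, RCLike.inner_apply, RCLike.inner_apply, RCLike.real_smul_eq_coe_mul,
      RCLike.real_smul_eq_coe_mul, map_mul, RCLike.conj_ofReal]
    ring
  · change mulL2 _ hs (mulL2 _ hs f) =ᵐ[volume] _
    filter_upwards [coeFn_mulL2 hs (mulL2 _ hs f), coeFn_mulL2 hs f, h0] with x h1 h2 h3
    rw [h1, h2, smul_smul, Real.mul_self_sqrt h3]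

/-- Elliptic regularity in one dimension: if `α f ∈ H¹` then `f ∈ H¹`, and
`f' = α⁻¹ (α f)' - α⁻¹ α' f` depends continuously on `(α f)'` and `f` in `L²`. -/
theorem exists_weakDeriv_of_mul {α : ℝ → ℝ} (hα : MemW1Inf α) {m : ℝ} (hm : 0 < m)
    (h : ∀ᵐ x, m ≤ α x) : ∃ M N : L2R 𝕜 →L[𝕜] L2R 𝕜, ∀ f q : L2R 𝕜,
      HasWeakDeriv (fun x => α x • f x) (q : ℝ → 𝕜) → (f, M q + N f) ∈ weakDerivGraph 𝕜 := by
  obtain ⟨hα0, α', hα', hd⟩ := hα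
  have hi := memLp_top_inv hα0.1 hm h
  refine ⟨mulL2 _ hi, -(mulL2 _ hi).comp (mulL2 _ hα'), fun f q hq => ?_⟩
  refine ((hd.inv hm h).smul hq).congr ?_ ?_
  · filter_upwards [h] with x hx
    rw [smul_smul, inv_mul_cancel₀ (hm.trans_le hx).ne', one_smul]
  · filter_upwards [h, Lp.coeFn_add (mulL2 _ hi q) ((-(mulL2 _ hi).comp (mulL2 _ hα')) f),
      Lp.coeFn_neg (mulL2 _ hi (mulL2 _ hα' f)), coeFn_mulL2 hi q,
      coeFn_mulL2 hi (mulL2 _ hα' f), coeFn_mulL2 hα' f] with x hx h1 h2 h3 h4 h5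
    rw [h1, Pi.add_apply, h3]
    congr 1
    refine h2.trans ?_
    have hx0 : α x ≠ 0 := (hm.trans_le hx).ne'
    rw [Pi.neg_apply, h4, h5, smul_smul, smul_smul, ← neg_smul]
    congr 1
    field_simp

/-- Multiplication by a `W^{1,∞}` function preserves `H¹`. -/
theorem exists_hasWeakDeriv_mul {α : ℝ → ℝ} (hα : MemW1Inf α) {f g : L2R 𝕜}
    (hf : (f, g) ∈ weakDerivGraph 𝕜) :
    ∃ q : L2R 𝕜, HasWeakDeriv (fun x => α x • f x) (q : ℝ → 𝕜) := by
  obtain ⟨hα0, α', hα', hd⟩ := hα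
  refine ⟨mulL2 _ hα0 g + mulL2 _ hα' f, (hd.smul hf).congr EventuallyEq.rfl ?_⟩
  filter_upwards [Lp.coeFn_add (mulL2 _ hα0 g) (mulL2 _ hα' f), coeFn_mulL2 hα0 g,
    coeFn_mulL2 hα' f] with x h1 h2 h3
  rw [h1, Pi.add_apply, h2, h3]

namespace Hk

variable {k : ℕ}

/-- The norm of `H^k` induces convergence of all derivatives in `L²`. -/
theorem tendsto_of_wderiv {ι : Type*} {l : Filter ι} {F : ι → Hk 𝕜 k} {x : Hk 𝕜 k}
    (h : ∀ i, Tendsto (fun a => wderiv (F a) i) l (𝓝 (wderiv x i))) : Tendsto F l (𝓝 x) := by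
  rw [tendsto_subtype_rng]
  exact ((PiLp.continuous_toLp 2 fun _ : Fin (k + 1) => L2R 𝕜).tendsto _).comp
    (tendsto_pi_nhds.2 h)

theorem continuousOn_of_wderiv {F : ℝ → Hk 𝕜 k} {s : Set ℝ}
    (h : ∀ i, ContinuousOn (fun t => wderiv (F t) i) s) : ContinuousOn F s :=
  fun t ht => tendsto_of_wderiv fun i => h i t ht

theorem continuous_wderiv (i : Fin (k + 1)) : Continuous fun f : Hk 𝕜 k => wderiv f i :=
  (PiLp.continuous_apply 2 (fun _ : Fin (k + 1) => L2R 𝕜) i).comp continuous_subtype_val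

theorem hasDerivWithinAt_of_wderiv {F : ℝ → Hk 𝕜 k} {F' : Hk 𝕜 k} {s : Set ℝ} {t : ℝ}
    (h : ∀ i, HasDerivWithinAt (fun t => wderiv (F t) i) (wderiv F' i) s t) :
    HasDerivWithinAt F F' s t := by
  rw [hasDerivWithinAt_iff_tendsto_slope]
  exact tendsto_of_wderiv fun i => hasDerivWithinAt_iff_tendsto_slope.1 (h i)

theorem mem_weakDerivGraph (f : Hk 𝕜 k) (i : Fin k) :
    (wderiv f i.castSucc, wderiv f i.succ) ∈ weakDerivGraph 𝕜 := f.2 i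

theorem toL2_injective : Function.Injective (toL2 : Hk 𝕜 1 → L2R 𝕜) := by
  intro f g h
  have h1 : wderiv f 1 = wderiv g 1 := by
    have hf := mem_weakDerivGraph f 0
    have hg := mem_weakDerivGraph g 0
    refine weakDerivGraph_unique hf ?_
    change wderiv f 0 = wderiv g 0 at h
    have : (wderiv f (Fin.castSucc 0)) = wderiv g (Fin.castSucc 0) := h
    rw [this]
    exact hg
  refine Subtype.ext (WithLp.ofLp_injective 2 (funext fun i => ?_))
  fin_cases i
  · exact h
  · exact h1

/-- The element `(f, g)` of `H¹`. -/
def mkOne {f g : L2R 𝕜} (h : (f, g) ∈ weakDerivGraph 𝕜) : Hk 𝕜 1 :=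
  ⟨WithLp.toLp 2 ![f, g], fun i => by
    fin_cases i
    exact h⟩

/-- The element `(f, g, h)` of `H²`. -/
def mkTwo {f g h : L2R 𝕜} (h₁ : (f, g) ∈ weakDerivGraph 𝕜) (h₂ : (g, h) ∈ weakDerivGraph 𝕜) :
    Hk 𝕜 2 :=
  ⟨WithLp.toLp 2 ![f, g, h], fun i => by
    fin_cases i
    · exact h₁
    · exact h₂⟩

theorem norm_wderiv_le (f : Hk 𝕜 k) (i : Fin (k + 1)) : ‖wderiv f i‖ ≤ ‖f‖ :=
  PiLp.norm_apply_le (f : PiLp 2 fun _ : Fin (k + 1) => L2R 𝕜) i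

theorem norm_le_add (f : Hk 𝕜 1) : ‖f‖ ≤ ‖toL2 f‖ + ‖wderiv f 1‖ := by
  have h : ‖f‖ ^ 2 = ‖toL2 f‖ ^ 2 + ‖wderiv f 1‖ ^ 2 := by
    have := PiLp.norm_sq_eq_of_L2 (fun _ : Fin 2 => L2R 𝕜) (f : PiLp 2 fun _ : Fin 2 => L2R 𝕜)
    rw [Fin.sum_univ_two] at this
    exact this
  refine le_of_sq_le_sq ?_ (by positivity)
  rw [h]
  nlinarith [norm_nonneg (toL2 f), norm_nonneg (wderiv f 1)]

end Hk

end SobolevSpaces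

/-! ### Solutions of the wave equation -/

noncomputable section WaveEquation

theorem contDiffOn_succ_of_hasDerivWithinAt_Ici {E : Type*} [NormedAddCommGroup E]
    [NormedSpace ℝ E] {n : ℕ} {f f' : ℝ → E}
    (h : ∀ t, 0 ≤ t → HasDerivWithinAt f (f' t) (Ici 0) t) (h' : ContDiffOn ℝ n f' (Ici 0)) :
    ContDiffOn ℝ (n + 1 : ℕ) f (Ici 0) := by
  have := (contDiffOn_succ_iff_derivWithin (𝕜 := ℝ) (n := (n : ℕ∞ω)) (f := f)
    (uniqueDiffOn_Ici 0)).2 ⟨fun t ht => (h t ht).differentiableWithinAt, by simp,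
    h'.congr fun t ht => (h t ht).derivWithin (uniqueDiffOn_Ici 0 t ht)⟩
  exact_mod_cast this

theorem integral_fst_of_continuousOn {E : Type*} [NormedAddCommGroup E] [NormedSpace ℝ E]
    [CompleteSpace E] {W : ℝ → WithLp 2 (E × E)} (hW : ContinuousOn W (Ici 0)) {t : ℝ}
    (ht : 0 ≤ t) : (∫ s in (0 : ℝ)..t, W s).fst = ∫ s in (0 : ℝ)..t, (W s).fst :=
  ((WithLp.fstL 2 ℝ E E).intervalIntegral_comp_comm (hW.intervalIntegrable_of_nonneg ht)).symm

theorem integral_snd_of_continuousOn {E : Type*} [NormedAddCommGroup E] [NormedSpace ℝ E]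
    [CompleteSpace E] {W : ℝ → WithLp 2 (E × E)} (hW : ContinuousOn W (Ici 0)) {t : ℝ}
    (ht : 0 ≤ t) : (∫ s in (0 : ℝ)..t, W s).snd = ∫ s in (0 : ℝ)..t, (W s).snd :=
  ((WithLp.sndL 2 ℝ E E).intervalIntegral_comp_comm (hW.intervalIntegrable_of_nonneg ht)).symm

variable {𝕜 : Type*} [RCLike 𝕜]

theorem ContinuousLinearEquiv.integral_comp_of_continuousOn {H : Type*} [NormedAddCommGroup H]
    [NormedSpace 𝕜 H] [NormedSpace ℝ H] [CompleteSpace H] (P : H ≃L[𝕜] H) {f : ℝ → H}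
    (hf : ContinuousOn f (Ici 0)) {t : ℝ} (ht : 0 ≤ t) :
    ∫ s in (0 : ℝ)..t, P (f s) = P (∫ s in (0 : ℝ)..t, f s) :=
  (P : H →L[𝕜] H).intervalIntegral_comp_comm (hf.intervalIntegrable_of_nonneg ht)

theorem integral_mem_weakDerivGraph {f g : ℝ → L2R 𝕜} (hf : ContinuousOn f (Ici 0))
    (hg : ContinuousOn g (Ici 0)) (h : ∀ s, 0 ≤ s → (f s, g s) ∈ weakDerivGraph 𝕜) {t : ℝ}
    (ht : 0 ≤ t) :
    (∫ s in (0 : ℝ)..t, f s, ∫ s in (0 : ℝ)..t, g s) ∈ weakDerivGraph 𝕜 := by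
  have hc : ContinuousOn (fun s => (f s, g s)) (Ici 0) := hf.prodMk hg
  have h1 := Submodule.integral_mem_of_isClosed ((weakDerivGraph 𝕜).restrictScalars ℝ)
    (isSkewAdjointGraph_weakDerivGraph 𝕜).isClosed ht hc h
  have hi := hc.intervalIntegrable_of_nonneg ht
  have e1 := (ContinuousLinearMap.fst ℝ (L2R 𝕜) (L2R 𝕜)).intervalIntegral_comp_comm hi
  have e2 := (ContinuousLinearMap.snd ℝ (L2R 𝕜) (L2R 𝕜)).intervalIntegral_comp_comm hi
  have e : (∫ s in (0 : ℝ)..t, (f s, g s)) =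
      (∫ s in (0 : ℝ)..t, f s, ∫ s in (0 : ℝ)..t, g s) := Prod.ext e1.symm e2.symm
  rw [e] at h1
  exact h1

/-- When `P² = φ` and `Q² = χ` as multiplication operators, the flux equation
`∂ₓ(φ f) = χ g` becomes membership in the graph of the weak derivative on `L²`. -/
theorem mem_weakDerivGraph_sqrt_iff {φ χ : ℝ → ℝ} {P Q : L2R 𝕜 → L2R 𝕜}
    (hP : ∀ f, P (P f) =ᵐ[volume] fun x => φ x • f x)
    (hQ : ∀ f, Q (Q f) =ᵐ[volume] fun x => χ x • f x) (f g : L2R 𝕜) :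
    (P (P f), Q (Q g)) ∈ weakDerivGraph 𝕜 ↔
      HasWeakDeriv (fun x => φ x • f x) (fun x => χ x • g x) :=
  ⟨fun h => HasWeakDeriv.congr h (hP f).symm (hQ g).symm, fun h => h.congr (hP f) (hQ g)⟩

namespace IsWaveSolution

variable {α β : ℝ → ℝ} {u₀ : Hk 𝕜 1} {u₁ : L2R 𝕜} {u : ℝ → L2R 𝕜}

theorem hasDerivWithinAt (h : IsWaveSolution α β u₀ u₁ u) {t : ℝ} (ht : 0 ≤ t) :
    HasDerivWithinAt u (timeDeriv u t) (Ici 0) t :=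
  (h.memC1.differentiableOn (by simp) t ht).hasDerivWithinAt

theorem continuousOn (h : IsWaveSolution α β u₀ u₁ u) : ContinuousOn u (Ici 0) :=
  h.memC1.continuousOn

theorem continuousOn_timeDeriv (h : IsWaveSolution α β u₀ u₁ u) :
    ContinuousOn (timeDeriv u) (Ici 0) :=
  h.memC1.continuousOn_derivWithin (uniqueDiffOn_Ici 0) (by simp)

variable {P Q : L2R 𝕜 ≃L[𝕜] L2R 𝕜} (hP : ∀ f, P (P f) =ᵐ[volume] fun x => α x • f x)
  (hQ : ∀ f, Q (Q f) =ᵐ[volume] fun x => β x • f x)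
include hP hQ

/-- If `u` solves the wave equation, then `(√α ∂ₓu, √β ∂ₜu)` is a mild solution of the first-order
system. -/
theorem isMildSolution (h : IsWaveSolution α β u₀ u₁ u) {F : ℝ → Hk 𝕜 1}
    (hF : ContinuousOn F (Ici 0)) (hFu : ∀ t, 0 ≤ t → toL2 (F t) = u t) :
    IsMildSolution (waveGraph (weakDerivGraph 𝕜) P Q)
      (WithLp.toLp 2 (P (wderiv u₀ 1), Q u₁))
      (fun t => WithLp.toLp 2 (P (wderiv (F t) 1), Q (timeDeriv u t))) := by
  have hF1 : ContinuousOn (fun t => wderiv (F t) 1) (Ici 0) :=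
    (Hk.continuous_wderiv 1).comp_continuousOn hF
  have hu' := h.continuousOn_timeDeriv
  have hc : ContinuousOn (fun t => WithLp.toLp 2 (P (wderiv (F t) 1), Q (timeDeriv u t)))
      (Ici 0) :=
    (WithLp.prod_continuous_toLp 2 _ _).comp_continuousOn
      ((P.continuous.comp_continuousOn hF1).prodMk (Q.continuous.comp_continuousOn hu'))
  have hΓ : ∀ t, 0 ≤ t → (u t, wderiv (F t) 1) ∈ weakDerivGraph 𝕜 := fun t ht => by
    rw [← hFu t ht]
    exact Hk.mem_weakDerivGraph (F t) 0
  refine ⟨hc, fun t ht => mem_waveGraph.2 ⟨?_, ?_⟩⟩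
  · have e1 : (∫ s in (0 : ℝ)..t,
        WithLp.toLp 2 (P (wderiv (F s) 1), Q (timeDeriv u s))).snd = Q (u t - toL2 u₀) := by
      rw [integral_snd_of_continuousOn hc ht]
      change ∫ s in (0 : ℝ)..t, Q (timeDeriv u s) = _
      rw [Q.integral_comp_of_continuousOn hu' ht,
        integral_eq_sub_of_hasDerivWithinAt_Ici (fun s hs => h.hasDerivWithinAt hs) hu' ht, h.init]
    change (Q.symm (WithLp.snd (∫ s in (0 : ℝ)..t,
      WithLp.toLp 2 (P (wderiv (F s) 1), Q (timeDeriv u s)))), P.symm (P (wderiv (F t) 1) - P (wderiv u₀ 1))) ∈ _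
    rw [e1, ← map_sub, Q.symm_apply_apply, P.symm_apply_apply]
    exact (weakDerivGraph 𝕜).sub_mem (hΓ t ht) (Hk.mem_weakDerivGraph u₀ 0)
  · obtain ⟨U, hU, hUw⟩ := h.equation t ht
    have e1 : (∫ s in (0 : ℝ)..t,
        WithLp.toLp 2 (P (wderiv (F s) 1), Q (timeDeriv u s))).fst = P (wderiv U 1) := by
      rw [integral_fst_of_continuousOn hc ht]
      change ∫ s in (0 : ℝ)..t, P (wderiv (F s) 1) = _
      rw [P.integral_comp_of_continuousOn hF1 ht]
      congr 1
      refine weakDerivGraph_unique (integral_mem_weakDerivGraph h.continuousOn hF1 hΓ ht) ?_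
      rw [← hU]
      exact Hk.mem_weakDerivGraph U 0
    change (P (WithLp.fst (∫ s in (0 : ℝ)..t,
      WithLp.toLp 2 (P (wderiv (F s) 1), Q (timeDeriv u s)))), Q (Q (timeDeriv u t) - Q u₁)) ∈ _
    rw [e1, ← map_sub]
    exact (mem_weakDerivGraph_sqrt_iff hP hQ _ _).2 hUw

end IsWaveSolution

section

variable {α β : ℝ → ℝ} {u₀ : Hk 𝕜 1} {u₁ : L2R 𝕜} {P Q : L2R 𝕜 ≃L[𝕜] L2R 𝕜}
  (hP : ∀ f, P (P f) =ᵐ[volume] fun x => α x • f x)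
  (hQ : ∀ f, Q (Q f) =ᵐ[volume] fun x => β x • f x)
  (hG : IsMaxDissipative (waveGraph (weakDerivGraph 𝕜) P Q))
include hP hQ hG

/-- A mild solution `(a, c)` of the first-order system yields the solution `u₀ + ∫₀ᵗ c / √β` of the
wave equation. -/
theorem exists_isWaveSolution
    (hreg : ∀ f q, (P (P f), q) ∈ weakDerivGraph 𝕜 → ∃ g, (f, g) ∈ weakDerivGraph 𝕜) :
    ∃ u, IsWaveSolution α β u₀ u₁ u := by
  obtain ⟨W, hW, -⟩ := hG.exists_isMildSolution (WithLp.toLp 2 (P (wderiv u₀ 1), Q u₁))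
  have hW0 := hG.isMildSolution_zero hW
  set v : ℝ → L2R 𝕜 := fun t => Q.symm (W t).snd with hv
  set g : ℝ → L2R 𝕜 := fun t => P.symm (W t).fst with hg
  have hvc : ContinuousOn v (Ici 0) := Q.symm.continuous.comp_continuousOn
    ((WithLp.sndL 2 𝕜 (L2R 𝕜) (L2R 𝕜)).continuous.comp_continuousOn hW.continuousOn)
  have hgc : ContinuousOn g (Ici 0) := P.symm.continuous.comp_continuousOn
    ((WithLp.fstL 2 𝕜 (L2R 𝕜) (L2R 𝕜)).continuous.comp_continuousOn hW.continuousOn)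
  have hQv : ∀ t, Q (v t) = (W t).snd := fun t => Q.apply_symm_apply _
  have hPg : ∀ t, P (g t) = (W t).fst := fun t => P.apply_symm_apply _
  set u : ℝ → L2R 𝕜 := fun t => toL2 u₀ + ∫ s in (0 : ℝ)..t, v s with hu
  have hud : ∀ t, 0 ≤ t → HasDerivWithinAt u (v t) (Ici 0) t := fun t ht =>
    (hasDerivWithinAt_integral_Ici hvc ht).const_add _
  have huc : ContinuousOn u (Ici 0) := fun t ht => (hud t ht).continuousWithinAt
  have htd : ∀ t, 0 ≤ t → timeDeriv u t = v t := fun t ht =>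
    (hud t ht).derivWithin (uniqueDiffOn_Ici 0 t ht)
  have hmem : ∀ t, 0 ≤ t → (u t, g t) ∈ weakDerivGraph 𝕜 := by
    intro t ht
    have h1 := (mem_waveGraph.1 (hW.mem t ht)).1
    have e1 : Q.symm (∫ s in (0 : ℝ)..t, W s).snd = ∫ s in (0 : ℝ)..t, v s := by
      rw [integral_snd_of_continuousOn hW.continuousOn ht]
      simp only [← hQv]
      rw [Q.integral_comp_of_continuousOn hvc ht, Q.symm_apply_apply]
    have e2 : P.symm (W t - WithLp.toLp 2 (P (wderiv u₀ 1), Q u₁)).fst = g t - wderiv u₀ 1 := by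
      change P.symm ((W t).fst - P (wderiv u₀ 1)) = _
      rw [map_sub, P.symm_apply_apply]
    have h2 : (∫ s in (0 : ℝ)..t, v s, g t - wderiv u₀ 1) ∈ weakDerivGraph 𝕜 := by
      rw [← e1, ← e2]; exact h1
    have h3 := (weakDerivGraph 𝕜).add_mem (Hk.mem_weakDerivGraph u₀ 0) h2
    convert h3 using 1
    exact Prod.ext rfl (add_sub_cancel (wderiv u₀ 1) (g t)).symm
  refine ⟨u, contDiffOn_succ_of_hasDerivWithinAt_Ici (n := 0) hud ?_, ?_, ?_, ?_, ?_⟩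
  · rw [Nat.cast_zero, contDiffOn_zero]; exact hvc
  · refine ⟨fun t => Hk.mkOne (hmem (max t 0) (le_max_right t 0)), ?_, fun t ht => ?_⟩
    · rw [Nat.cast_zero, contDiffOn_zero]
      refine (Continuous.continuousOn ?_)
      refine continuous_iff_continuousAt.2 fun t => Hk.tendsto_of_wderiv fun i => ?_
      fin_cases i
      · exact huc.comp_max_zero.continuousAt
      · exact hgc.comp_max_zero.continuousAt
    · change u (max t 0) = u t
      rw [max_eq_left ht]
  · simp [hu]
  · rw [htd 0 le_rfl]
    simp only [hv, hW0]
    exact Q.symm_apply_apply u₁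
  · intro t ht
    have h1 := (mem_waveGraph.1 (hW.mem t ht)).2
    have e1 : (∫ s in (0 : ℝ)..t, W s).fst = P (∫ s in (0 : ℝ)..t, g s) := by
      rw [integral_fst_of_continuousOn hW.continuousOn ht]
      simp only [← hPg]
      rw [P.integral_comp_of_continuousOn hgc ht]
    have e2 : (W t - WithLp.toLp 2 (P (wderiv u₀ 1), Q u₁)).snd = Q (timeDeriv u t - u₁) := by
      rw [WithLp.sub_snd, htd t ht, map_sub, hQv]
      rfl
    simp only [e1, e2] at h1
    obtain ⟨k, hk⟩ := hreg _ _ h1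
    exact ⟨Hk.mkTwo (integral_mem_weakDerivGraph huc hgc hmem ht) hk, rfl,
      (mem_weakDerivGraph_sqrt_iff hP hQ _ _).1 h1⟩

theorem isWaveSolution_unique {u w : ℝ → L2R 𝕜} (hu : IsWaveSolution α β u₀ u₁ u)
    (hw : IsWaveSolution α β u₀ u₁ w) {t : ℝ} (ht : 0 ≤ t) : w t = u t := by
  obtain ⟨F, hF, hFu⟩ := hu.memC0
  obtain ⟨K, hK, hKw⟩ := hw.memC0
  have htd : ∀ s, 0 ≤ s → timeDeriv w s = timeDeriv u s := fun s hs => by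
    have := hG.isMildSolution_unique (hw.isMildSolution hP hQ hK.continuousOn hKw)
      (hu.isMildSolution hP hQ hF.continuousOn hFu) hs
    exact Q.injective (congrArg WithLp.snd this)
  have e1 := integral_eq_sub_of_hasDerivWithinAt_Ici (fun s hs => hu.hasDerivWithinAt hs)
    hu.continuousOn_timeDeriv ht
  have e2 := integral_eq_sub_of_hasDerivWithinAt_Ici (fun s hs => hw.hasDerivWithinAt hs)
    hw.continuousOn_timeDeriv ht
  have e3 : ∫ s in (0 : ℝ)..t, timeDeriv w s = ∫ s in (0 : ℝ)..t, timeDeriv u s :=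
    intervalIntegral.integral_congr fun s hs => by
      rw [uIcc_of_le ht] at hs
      exact htd s hs.1
  rw [e1, e2, hu.init, hw.init] at e3
  exact sub_left_injective e3

omit u₀ u₁ in
/-- Continuous dependence on the data: the `L²` norm of `(√α ∂ₓu, √β ∂ₜu)` does not grow, and
`‖u(t)‖ ≤ ‖u₀‖ + ∫₀ᵗ ‖∂ₜu‖`. -/
theorem exists_norm_add_norm_timeDeriv_le {T : ℝ} (hT : 0 < T) : ∃ C : ℝ, 0 < C ∧
    ∀ (u₀ : Hk 𝕜 1) (u₁ : L2R 𝕜) (u : ℝ → L2R 𝕜), IsWaveSolution α β u₀ u₁ u →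
      ∀ t : ℝ, 0 ≤ t → t ≤ T → ∀ U : Hk 𝕜 1, toL2 U = u t →
        ‖U‖ + ‖timeDeriv u t‖ ≤ C * (‖u₀‖ + ‖u₁‖) := by
  set p := ‖(P : L2R 𝕜 →L[𝕜] L2R 𝕜)‖
  set q := ‖(Q : L2R 𝕜 →L[𝕜] L2R 𝕜)‖
  set p' := ‖(P.symm : L2R 𝕜 →L[𝕜] L2R 𝕜)‖
  set q' := ‖(Q.symm : L2R 𝕜 →L[𝕜] L2R 𝕜)‖
  refine ⟨1 + (p' + (T + 1) * q') * (p + q), by positivity, fun u₀ u₁ u hu t ht htT U hU => ?_⟩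
  obtain ⟨F, hF, hFu⟩ := hu.memC0
  have hmild := hu.isMildSolution hP hQ hF.continuousOn hFu
  set S := ‖u₀‖ + ‖u₁‖
  have hS : 0 ≤ S := by positivity
  set N := ‖WithLp.toLp 2 (P (wderiv u₀ 1), Q u₁)‖
  have hN : N ≤ (p + q) * S := by
    have h1 : N ≤ ‖P (wderiv u₀ 1)‖ + ‖Q u₁‖ := by
      refine le_of_sq_le_sq ?_ (by positivity)
      rw [WithLp.prod_norm_sq_eq_of_L2]
      change ‖P (wderiv u₀ 1)‖ ^ 2 + ‖Q u₁‖ ^ 2 ≤ _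
      nlinarith [norm_nonneg (P (wderiv u₀ 1)), norm_nonneg (Q u₁)]
    have h2 : ‖P (wderiv u₀ 1)‖ ≤ p * ‖u₀‖ :=
      ((P : L2R 𝕜 →L[𝕜] L2R 𝕜).le_opNorm _).trans (by gcongr; exact Hk.norm_wderiv_le u₀ 1)
    have h3 : ‖Q u₁‖ ≤ q * ‖u₁‖ := (Q : L2R 𝕜 →L[𝕜] L2R 𝕜).le_opNorm _
    have h4 : 0 ≤ p * ‖u₁‖ := by positivity
    have h5 : 0 ≤ q * ‖u₀‖ := by positivity
    simp only [S]
    nlinarith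
  have hux : ∀ s, 0 ≤ s → ‖wderiv (F s) 1‖ ≤ p' * N := fun s hs => by
    have h1 := hG.norm_isMildSolution_le hmild hs
    have h2 := (WithLp.norm_fst_le (x := WithLp.toLp 2 (P (wderiv (F s) 1), Q (timeDeriv u s))))
    have h3 := (P.symm : L2R 𝕜 →L[𝕜] L2R 𝕜).le_opNorm (P (wderiv (F s) 1))
    rw [ContinuousLinearEquiv.coe_coe, P.symm_apply_apply] at h3
    exact h3.trans (by gcongr; exact h2.trans h1)
  have hut : ∀ s, 0 ≤ s → ‖timeDeriv u s‖ ≤ q' * N := fun s hs => by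
    have h1 := hG.norm_isMildSolution_le hmild hs
    have h2 := (WithLp.norm_snd_le (x := WithLp.toLp 2 (P (wderiv (F s) 1), Q (timeDeriv u s))))
    have h3 := (Q.symm : L2R 𝕜 →L[𝕜] L2R 𝕜).le_opNorm (Q (timeDeriv u s))
    rw [ContinuousLinearEquiv.coe_coe, Q.symm_apply_apply] at h3
    exact h3.trans (by gcongr; exact h2.trans h1)
  have hu0 : ‖u t‖ ≤ S + T * (q' * N) := by
    have h1 := norm_image_sub_le_of_norm_deriv_le_segment' (f := u) (a := 0) (b := t)
      (fun s hs => (hu.hasDerivWithinAt hs.1).mono Icc_subset_Ici_self)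
      (fun s hs => hut s hs.1) t ⟨ht, le_rfl⟩
    have h2 : ‖u 0‖ ≤ S := by
      rw [hu.init]
      exact (Hk.norm_wderiv_le u₀ 0).trans (le_add_of_nonneg_right (norm_nonneg _))
    have h3 : q' * N * (t - 0) ≤ T * (q' * N) := by
      rw [mul_comm, sub_zero]; gcongr
    calc ‖u t‖ = ‖u 0 + (u t - u 0)‖ := by rw [add_sub_cancel]
      _ ≤ ‖u 0‖ + ‖u t - u 0‖ := norm_add_le _ _
      _ ≤ _ := by linarith
  have hUF : U = F t := Hk.toL2_injective (hU.trans (hFu t ht).symm)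
  have h1 := Hk.norm_le_add U
  rw [hU] at h1
  have h2 := hux t ht
  rw [← hUF] at h2
  have h3 := hut t ht
  have h4 : (p' + (T + 1) * q') * N ≤ (p' + (T + 1) * q') * ((p + q) * S) := by gcongr
  linarith

/-- Initial data in `H² × H¹` put `(√α u₀', √β u₁)` in the domain of the wave operator, so that
`(√α ∂ₓu, √β ∂ₜu)` is `C¹`. The operators `M` and `N` recover `∂ₓ²u` from `∂ₓ(α ∂ₓu)` and `∂ₓu`. -/
theorem IsWaveSolution.regularity {M N : L2R 𝕜 →L[𝕜] L2R 𝕜}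
    (hreg : ∀ f q, (P (P f), q) ∈ weakDerivGraph 𝕜 → (f, M q + N f) ∈ weakDerivGraph 𝕜)
    (hmul : ∀ f g, (f, g) ∈ weakDerivGraph 𝕜 → ∃ q, (P (P f), q) ∈ weakDerivGraph 𝕜)
    {u : ℝ → L2R 𝕜} (hu : IsWaveSolution α β u₀ u₁ u)
    (h₀ : MemHk 2 (toL2 u₀)) (h₁ : MemHk 1 u₁) :
    MemCmL2 2 u ∧ MemCmHk 1 1 u ∧ MemCmHk 0 2 u := by
  obtain ⟨F, hF, hFu⟩ := hu.memC0
  have hmild := hu.isMildSolution hP hQ hF.continuousOn hFu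
  obtain ⟨V₁, hV₁⟩ := h₁
  obtain ⟨V₀, hV₀⟩ := h₀
  have hu₀ : (wderiv u₀ 1, wderiv V₀ 2) ∈ weakDerivGraph 𝕜 := by
    have e : wderiv u₀ 1 = wderiv V₀ 1 := by
      refine weakDerivGraph_unique (Hk.mem_weakDerivGraph u₀ 0) ?_
      change (toL2 u₀, _) ∈ _
      rw [← hV₀]
      exact Hk.mem_weakDerivGraph V₀ 0
    rw [e]
    exact Hk.mem_weakDerivGraph V₀ 1
  obtain ⟨d, hd⟩ := hmul _ _ hu₀
  have hdom : (WithLp.toLp 2 (P (wderiv u₀ 1), Q u₁),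
      WithLp.toLp 2 (P (wderiv V₁ 1), Q.symm d)) ∈ waveGraph (weakDerivGraph 𝕜) P Q := by
    refine mem_waveGraph.2 ⟨?_, ?_⟩
    · change (Q.symm (Q u₁), P.symm (P (wderiv V₁ 1))) ∈ _
      rw [Q.symm_apply_apply, P.symm_apply_apply, ← hV₁]
      exact Hk.mem_weakDerivGraph V₁ 0
    · change (P (P (wderiv u₀ 1)), Q (Q.symm d)) ∈ _
      rw [Q.apply_symm_apply]
      exact hd
  obtain ⟨V, hVc, hV⟩ := hG.exists_hasDerivWithinAt_of_mem hdom hmild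
  set ux' : ℝ → L2R 𝕜 := fun t => P.symm (V t).fst with hux'
  set ut' : ℝ → L2R 𝕜 := fun t => Q.symm (V t).snd with hut'
  have hV1 : ContinuousOn (fun t => (V t).fst) (Ici 0) :=
    (WithLp.fstL 2 𝕜 (L2R 𝕜) (L2R 𝕜)).continuous.comp_continuousOn hVc
  have hV2 : ContinuousOn (fun t => (V t).snd) (Ici 0) :=
    (WithLp.sndL 2 𝕜 (L2R 𝕜) (L2R 𝕜)).continuous.comp_continuousOn hVc
  have hux'c : ContinuousOn ux' (Ici 0) := P.symm.continuous.comp_continuousOn hV1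
  have hut'c : ContinuousOn ut' (Ici 0) := Q.symm.continuous.comp_continuousOn hV2
  have hF0 : ContinuousOn (fun t => wderiv (F t) 0) (Ici 0) :=
    (Hk.continuous_wderiv 0).comp_continuousOn hF.continuousOn
  have hF1 : ContinuousOn (fun t => wderiv (F t) 1) (Ici 0) :=
    (Hk.continuous_wderiv 1).comp_continuousOn hF.continuousOn
  have hFd : ∀ t, 0 ≤ t → HasDerivWithinAt (fun t => wderiv (F t) 1) (ux' t) (Ici 0) t := by
    intro t ht
    have h1 := (((P.symm : L2R 𝕜 →L[𝕜] L2R 𝕜).comp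
      (WithLp.fstL 2 𝕜 (L2R 𝕜) (L2R 𝕜))).restrictScalars ℝ).hasFDerivAt.comp_hasDerivWithinAt t
      (hV t ht).1
    refine h1.congr (fun s _ => ?_) ?_ <;> exact (P.symm_apply_apply _).symm
  have hutd : ∀ t, 0 ≤ t → HasDerivWithinAt (timeDeriv u) (ut' t) (Ici 0) t := by
    intro t ht
    have h1 := (((Q.symm : L2R 𝕜 →L[𝕜] L2R 𝕜).comp
      (WithLp.sndL 2 𝕜 (L2R 𝕜) (L2R 𝕜))).restrictScalars ℝ).hasFDerivAt.comp_hasDerivWithinAt t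
      (hV t ht).1
    refine h1.congr (fun s _ => ?_) ?_ <;> exact (Q.symm_apply_apply _).symm
  have hmem : ∀ t, 0 ≤ t → (timeDeriv u t, ux' t) ∈ weakDerivGraph 𝕜 := fun t ht => by
    have : (Q.symm (Q (timeDeriv u t)), ux' t) ∈ weakDerivGraph 𝕜 :=
      (mem_waveGraph.1 (hV t ht).2).1
    rwa [Q.symm_apply_apply] at this
  have hmem2 : ∀ t, 0 ≤ t →
      (wderiv (F t) 1, M (Q (V t).snd) + N (wderiv (F t) 1)) ∈ weakDerivGraph 𝕜 := fun t ht =>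
    hreg _ _ (mem_waveGraph.1 (hV t ht).2).2
  refine ⟨?_, ⟨F, ?_, hFu⟩, ?_⟩
  · refine contDiffOn_succ_of_hasDerivWithinAt_Ici (n := 1)
      (fun t ht => hu.hasDerivWithinAt ht) ?_
    refine contDiffOn_succ_of_hasDerivWithinAt_Ici (n := 0) hutd ?_
    rw [Nat.cast_zero, contDiffOn_zero]
    exact hut'c
  · let F' : ℝ → Hk 𝕜 1 := fun t => Hk.mkOne (hmem (max t 0) (le_max_right t 0))
    refine contDiffOn_succ_of_hasDerivWithinAt_Ici (n := 0) (f' := F') (fun t ht => ?_) ?_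
    · refine Hk.hasDerivWithinAt_of_wderiv fun i => ?_
      fin_cases i
      · change HasDerivWithinAt (fun t => toL2 (F t)) (timeDeriv u (max t 0)) (Ici 0) t
        rw [max_eq_left ht]
        exact (hu.hasDerivWithinAt ht).congr (fun s hs => hFu s hs) (hFu t ht)
      · change HasDerivWithinAt (fun t => wderiv (F t) 1) (ux' (max t 0)) (Ici 0) t
        rw [max_eq_left ht]
        exact hFd t ht
    · rw [Nat.cast_zero, contDiffOn_zero]
      refine Hk.continuousOn_of_wderiv fun i => ?_
      fin_cases i
      · exact hu.continuousOn_timeDeriv.comp_max_zero.continuousOn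
      · exact hux'c.comp_max_zero.continuousOn
  · have hΓ : ∀ t, 0 ≤ t → (wderiv (F t) 0, wderiv (F t) 1) ∈ weakDerivGraph 𝕜 := fun t _ =>
      Hk.mem_weakDerivGraph (F t) 0
    refine ⟨fun t => Hk.mkTwo (hΓ (max t 0) (le_max_right t 0))
      (hmem2 (max t 0) (le_max_right t 0)), ?_, fun t ht => ?_⟩
    · rw [Nat.cast_zero, contDiffOn_zero]
      refine Hk.continuousOn_of_wderiv fun i => ?_
      fin_cases i
      · exact hF0.comp_max_zero.continuousOn
      · exact hF1.comp_max_zero.continuousOn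
      · exact (((M.continuous.comp_continuousOn (Q.continuous.comp_continuousOn hV2)).add
          (N.continuous.comp_continuousOn hF1)).comp_max_zero).continuousOn
    · change toL2 (F (max t 0)) = u t
      rw [max_eq_left ht, hFu t ht]

end

end WaveEquation

theorem proposition1 {𝕜 : Type*} [RCLike 𝕜] (α β : ℝ → ℝ) (αmin βmin : ℝ)
    (hα : MemW1Inf α) (hβ : MemLp β ∞ volume)
    (hαmin : 0 < αmin) (hβmin : 0 < βmin)
    (hα_lower : ∀ᵐ x : ℝ, αmin ≤ α x) (hβ_lower : ∀ᵐ x : ℝ, βmin ≤ β x) :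
    -- existence and uniqueness
    (∀ (u₀ : Hk 𝕜 1) (u₁ : L2R 𝕜), ∃ u : ℝ → L2R 𝕜, IsWaveSolution α β u₀ u₁ u ∧
      ∀ w : ℝ → L2R 𝕜, IsWaveSolution α β u₀ u₁ w → ∀ t : ℝ, 0 ≤ t → w t = u t) ∧
    -- continuous dependence on the data
    (∀ T : ℝ, 0 < T → ∃ C : ℝ, 0 < C ∧
      ∀ (u₀ : Hk 𝕜 1) (u₁ : L2R 𝕜) (u : ℝ → L2R 𝕜), IsWaveSolution α β u₀ u₁ u →
        ∀ t : ℝ, 0 ≤ t → t ≤ T → ∀ U : Hk 𝕜 1, toL2 U = u t →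
          ‖U‖ + ‖timeDeriv u t‖ ≤ C * (‖u₀‖ + ‖u₁‖)) ∧
    -- regularity
    (∀ (u₀ : Hk 𝕜 1) (u₁ : L2R 𝕜) (u : ℝ → L2R 𝕜), IsWaveSolution α β u₀ u₁ u →
      MemHk 2 (toL2 u₀) → MemHk 1 u₁ →
        MemCmL2 2 u ∧ MemCmHk 1 1 u ∧ MemCmHk 0 2 u) := by
  obtain ⟨P, hPs, hP⟩ := exists_mulL2_sqrt (𝕜 := 𝕜) hα.1 hαmin hα_lower
  obtain ⟨Q, hQs, hQ⟩ := exists_mulL2_sqrt (𝕜 := 𝕜) hβ hβmin hβ_lower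
  obtain ⟨M, N, hMN⟩ := exists_weakDeriv_of_mul (𝕜 := 𝕜) hα hαmin hα_lower
  have hreg : ∀ f q, (P (P f), q) ∈ weakDerivGraph 𝕜 → (f, M q + N f) ∈ weakDerivGraph 𝕜 :=
    fun f q h => hMN f q (HasWeakDeriv.congr h (hP f).symm EventuallyEq.rfl)
  have hmul : ∀ f g, (f, g) ∈ weakDerivGraph 𝕜 → ∃ q, (P (P f), q) ∈ weakDerivGraph 𝕜 :=
    fun f g h => (exists_hasWeakDeriv_mul hα h).imp fun q hq =>
      HasWeakDeriv.congr hq (hP f) EventuallyEq.rfl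
  have hG := isMaxDissipative_waveGraph (isSkewAdjointGraph_weakDerivGraph 𝕜) hPs hQs
  refine ⟨fun u₀ u₁ => ?_, fun T hT => exists_norm_add_norm_timeDeriv_le hP hQ hG hT,
    fun u₀ u₁ u hu h₀ h₁ => hu.regularity hP hQ hG hreg hmul h₀ h₁⟩
  obtain ⟨u, hu⟩ := exists_isWaveSolution hP hQ hG (fun f q h => ⟨_, hreg f q h⟩)
  exact ⟨u, hu, fun w hw t ht => isWaveSolution_unique hP hQ hG hu hw ht⟩
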